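/- Let $S_6(\Gamma_0(4))$ be the space of cusp forms of weight $6$ and trivial character for $\Gamma_0(4)$, and write $q=e^{2\pi i z}$. By a newform in this space we mean a cusp form that is orthogonal, for the Petersson product, to all forms $g(dz)$ with $g\in S_6(\Gamma_0(M))$, $M$ a proper divisor of $4$ and $d\mid 4/M$, that is an eigenfunction of all Hecke operators $T_p$ ($p$ prime, with $T_2=U_2$), and whose first Fourier coefficient is $1$. Let $$\theta(z)=\sum_{n\in\mathbb Z}q^{n^2}=\sum_{m\ge 0}b(m)q^m .$$ The space $S_6(\Gamma_0(4))$ is one-dimensional, and it contains exactly one newform $\Delta_{4,6}(z)=\sum_{n\ge 1}\tau_{4,6}(n)q^n$, which therefore spans it. Put $\tau_{4,6}(n)=0$ for $n\le 0$, and let $a(n)$ be the $n$-th Fourier coefficient of the product $\theta\,\Delta_{4,6}$, so that $a(n)=\sum_{r=0}^{n}b(r)\,\tau_{4,6}(n-r)$ for all $n\ge 0$. Then the following series converge absolutely, and their sums are positive real numbers: $$\sum_{m=1}^{\infty}\frac{a(m+1)\,\overline{b(m)}}{(m+1)^{11/2}}>0,$$ $$\sum_{m=1}^{\infty}\frac{\sum_{r\in\mathbb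 Z,\ |r|\le m}\tau_{4,6}(m^2+1-r^2)}{(m^2+1)^{11/2}}>0,$$ $$\sum_{m=1}^{\infty}\frac{\sum_{r=1}^{m^2+1}\tau_{4,6}(m^2+1-r^2)}{(m^2+1)^{11/2}}>0 .$$ -/

import Mathlib

open UpperHalfPlane MeasureTheory CongruenceSubgroup
open scoped MatrixGroups ComplexConjugate Modular

noncomputable section

namespace ThetaNewform

/-- The space `S_k(Γ₀(N))` of cusp forms of weight `k` and trivial character. -/
abbrev CuspSpace (N : ℕ) (k : ℤ) : Type :=
  CuspForm ((Gamma0 N : Subgroup SL(2, ℤ)) : Subgroup (GL (Fin 2) ℝ)) k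

/-- The `n`-th Fourier coefficient at infinity (in powers of `q = e^{2πiz}`) of a function on the
upper half-plane, for an integer index `n`; it is `0` for `n < 0`. -/
def fourierCoeff (f : ℍ → ℂ) (n : ℤ) : ℂ :=
  if 0 ≤ n then (qExpansion 1 f).coeff n.toNat else 0

/-- The theta function `θ(z) = ∑_{n ∈ ℤ} q^{n²}`. -/
def theta (z : ℍ) : ℂ :=
  ∑' n : ℤ, Complex.exp (2 * Real.pi * Complex.I * (n : ℂ) ^ 2 * (z : ℂ))

/-- The function `z ↦ g(dz)`, for `d ≥ 1`. -/
def levelRaise (d : ℕ) (g : ℍ → ℂ) (z : ℍ) : ℂ :=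
  g (ofComplex ((d : ℂ) * (z : ℂ)))

/-- The Petersson product `⟨f, g⟩ = ∫_{Γ₀(N)\ℍ} f(z) \overline{g(z)} y^k dx dy / y²`.
The domain of integration is the union of the translates `γ⁻¹𝒟` of the standard fundamental
domain `𝒟` of `SL(2, ℤ)`, with `γ` running through representatives of `SL(2, ℤ) / Γ₀(N)`. -/
def peterssonProduct (N : ℕ) (k : ℤ) (f g : ℍ → ℂ) : ℂ :=
  ∫ z in 𝒟, ∑ᶠ c : SL(2, ℤ) ⧸ Gamma0 N, petersson k g f ((c.out)⁻¹ • z)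

/-- `f ∈ S_k(Γ₀(N))` lies in the new subspace: it is orthogonal to every `g(dz)` with
`g ∈ S_k(Γ₀(M))`, where `M` is a proper divisor of `N` and `d` divides `N / M`. -/
def IsNew {N : ℕ} {k : ℤ} (f : CuspSpace N k) : Prop :=
  ∀ M d : ℕ, M ≠ N → M * d ∣ N → ∀ g : CuspSpace M k,
    peterssonProduct N k f (levelRaise d g) = 0

/-- The Hecke operator `T_p` of weight `k` and level `N` (for `p ∣ N` it is also called `U_p`):
`(T_p f)(z) = p^{k-1} f(pz) + p⁻¹ ∑_{0 ≤ j < p} f((z + j) / p)`, without the first term when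
`p ∣ N`. -/
def heckeT (N : ℕ) (k : ℤ) (p : ℕ) (f : ℍ → ℂ) (z : ℍ) : ℂ :=
  (if p ∣ N then 0 else (p : ℂ) ^ (k - 1) * levelRaise p f z) +
    (p : ℂ)⁻¹ * ∑ j ∈ Finset.range p, f (ofComplex (((z : ℂ) + (j : ℂ)) / (p : ℂ)))

/-- `f` is a newform of level `N` and weight `k` with trivial character: it lies in the new
subspace of `S_k(Γ₀(N))`, is an eigenfunction of every Hecke operator `T_p`, and is normalised
by `a(1) = 1`. -/
def IsNewform {N : ℕ} {k : ℤ} (f : CuspSpace N k) : Prop :=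
  IsNew f ∧ (∀ p : ℕ, p.Prime → ∃ c : ℂ, ∀ z : ℍ, heckeT N k p f z = c * f z) ∧
    fourierCoeff f 1 = 1

/-- The series of complex numbers `∑_{m ≥ 1} u(m)` converges (absolutely), and its sum is a
positive real number. -/
def HasPositiveSum (u : ℕ+ → ℂ) : Prop :=
  ∃ S : ℝ, 0 < S ∧ HasSum u (S : ℂ)

end ThetaNewform

end

noncomputable section

open scoped Manifold ModularForm
open Function.Periodic (qParam)

namespace ThetaNewform

/-! ### The integer power series `∑ₖ (-1)ᵏ (2k+1) X^{k(k+1)/2}` and its fourth power -/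

/-! The newform is `η(2z)¹²`. By Jacobi's identity `η³ = ∑ (-1)ᵏ (2k+1) q^{(2k+1)²/8}`, the function
`η¹²` is `q^{1/2}` times the fourth power of a sparse series. That expression serves here as the
definition (`etaTwelve`), so no infinite product is needed. The series is the derivative in the
elliptic variable of Jacobi's theta function at the half period `(z+1)/2`. Its functional equation
shows that `η¹²` has weight 6 and changes sign under both `S` and `T`.

The square of `η¹²` is a cusp form of level one and weight 12, hence a multiple of the discriminant,
so `η¹²` has no zeros (`etaTwelve_ne_zero`). Dividing a weight 6 cusp form for `Γ(2)` by it leaves a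
constant (`exists_eq_mul_etaTwelve`). Conjugation by `diag(2, 1)` carries this to `Γ₀(4)` and gives
dimension one. At levels 1 and 2 the sign character leaves only the zero form, so the orthogonality
condition is empty. For odd `p`, applying `T_p` preserves the transformation laws of `η¹²`, so
one-dimensionality makes it an eigenfunction; `U_2` annihilates `η(2z)¹²`.

For positivity, `b` is supported on squares, so the first series is twice the second. The sparse
series gives the elementary bound `|τ(n)| ≤ 2m⁷` for `n ≤ m²+1` (`abs_tau_le`). The numerators are
then `O(m⁸)` against denominators of size `m¹¹`. The term `m = 1` outweighs the negative parts of
the terms `2 ≤ m ≤ 8`, computed exactly, together with a telescoping bound for `m ≥ 9`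
(`exists_pos_hasSum_seriesTerm`). -/

/-- The `j`-th coefficient of `∑ₖ (-1)ᵏ (2k+1) X^{k(k+1)/2}`. -/
def jacobiCoeff (j : ℕ) : ℤ :=
  ∑ k ∈ Finset.range (j + 1), if k * (k + 1) = 2 * j then (-1) ^ k * (2 * k + 1) else 0

/-- The power series `∑ₖ (-1)ᵏ (2k+1) X^{k(k+1)/2}`. -/
def jacobiSeries : PowerSeries ℤ := PowerSeries.mk jacobiCoeff

lemma triangle_inj {k l : ℕ} (h : k * (k + 1) = l * (l + 1)) : k = l := by
  rcases lt_trichotomy k l with h1 | h1 | h1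
  · nlinarith
  · exact h1
  · nlinarith

lemma jacobiCoeff_triangle {j k : ℕ} (h : k * (k + 1) = 2 * j) :
    jacobiCoeff j = (-1) ^ k * (2 * k + 1) := by
  rw [jacobiCoeff, Finset.sum_eq_single k]
  · simp [h]
  · intro l _ hl
    rw [if_neg]
    exact fun h' => hl (triangle_inj (h'.trans h.symm))
  · intro hk
    exact absurd (Finset.mem_range.mpr (by nlinarith)) hk

lemma jacobiCoeff_eq_zero {j : ℕ} (h : ∀ k : ℕ, k * (k + 1) ≠ 2 * j) : jacobiCoeff j = 0 :=
  Finset.sum_eq_zero fun k _ => if_neg (h k)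

/-- The only possible nonzero value is `±(2k+1)` with `k(k+1) = 2j ≤ m²`, which forces `k ≤ m - 1`.
-/
lemma abs_jacobiCoeff_le {j m : ℕ} (hm : 1 ≤ m) (h : 2 * j ≤ m ^ 2) :
    |jacobiCoeff j| ≤ 2 * m - 1 := by
  by_cases hk : ∃ k : ℕ, k * (k + 1) = 2 * j
  · obtain ⟨k, hk⟩ := hk
    have hkm : k < m := by by_contra hkm; push Not at hkm; nlinarith
    rw [jacobiCoeff_triangle hk, abs_mul, abs_pow, abs_neg, abs_one, one_pow, one_mul,
      abs_of_nonneg (by positivity)]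
    omega
  · push Not at hk
    rw [jacobiCoeff_eq_zero hk, abs_zero]
    omega

/-- Only `k < m` contribute, each for at most one `j`, and the first `m` odd numbers add up to `m²`.
-/
lemma sum_abs_jacobiCoeff_le {N m : ℕ} (hm : 1 ≤ m) (h : 2 * N ≤ m ^ 2) :
    ∑ j ∈ Finset.range (N + 1), |jacobiCoeff j| ≤ (m : ℤ) ^ 2 := by
  have hodd : ∀ m : ℕ, ∑ k ∈ Finset.range m, (2 * (k : ℤ) + 1) = (m : ℤ) ^ 2 := by
    intro m
    induction m with
    | zero => simp
    | succ n ih => rw [Finset.sum_range_succ, ih]; push_cast; ring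
  calc ∑ j ∈ Finset.range (N + 1), |jacobiCoeff j|
      ≤ ∑ j ∈ Finset.range (N + 1), ∑ k ∈ Finset.range m,
          if k * (k + 1) = 2 * j then (2 * (k : ℤ) + 1) else 0 := by
        refine Finset.sum_le_sum fun j hj => ?_
        have hj' := Finset.mem_range.mp hj
        have hnn : ∀ i ∈ Finset.range m,
            (0 : ℤ) ≤ if i * (i + 1) = 2 * j then (2 * (i : ℤ) + 1) else 0 := by
          intro i _; split_ifs <;> positivity
        by_cases hk : ∃ k : ℕ, k * (k + 1) = 2 * j
        · obtain ⟨k, hk⟩ := hk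
          have hkm : k < m := by by_contra hkm; push Not at hkm; nlinarith
          rw [jacobiCoeff_triangle hk, abs_mul, abs_pow, abs_neg, abs_one, one_pow, one_mul,
            abs_of_nonneg (by positivity)]
          simpa [hk] using Finset.single_le_sum hnn (Finset.mem_range.mpr hkm)
        · push Not at hk
          rw [jacobiCoeff_eq_zero hk, abs_zero]
          exact Finset.sum_nonneg hnn
    _ = ∑ k ∈ Finset.range m, ∑ j ∈ Finset.range (N + 1),
          if k * (k + 1) = 2 * j then (2 * (k : ℤ) + 1) else 0 := Finset.sum_comm
    _ ≤ ∑ k ∈ Finset.range m, (2 * (k : ℤ) + 1) := by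
        refine Finset.sum_le_sum fun k _ => ?_
        rw [← Finset.sum_filter, Finset.sum_const, nsmul_eq_mul]
        have : (Finset.filter (fun j => k * (k + 1) = 2 * j) (Finset.range (N + 1))).card ≤ 1 := by
          rw [Finset.card_le_one]
          intro a ha b hb
          simp only [Finset.mem_filter] at ha hb
          omega
        have h1 : ((Finset.filter (fun j => k * (k + 1) = 2 * j)
          (Finset.range (N + 1))).card : ℤ) ≤ 1 := by exact_mod_cast this
        nlinarith
    _ = (m : ℤ) ^ 2 := hodd m

lemma abs_coeff_mul_le (A B : PowerSeries ℤ) {N : ℕ} {a : ℤ}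
    (ha : ∀ i ≤ N, |A.coeff i| ≤ a) :
    |(A * B).coeff N| ≤ a * ∑ j ∈ Finset.range (N + 1), |B.coeff j| := by
  rw [PowerSeries.coeff_mul, Finset.Nat.sum_antidiagonal_eq_sum_range_succ_mk,
    ← Finset.sum_range_reflect (fun j => |B.coeff j|), Finset.mul_sum]
  refine (Finset.abs_sum_le_sum_abs _ _).trans (Finset.sum_le_sum fun i hi => ?_)
  rw [abs_mul, Nat.add_sub_cancel]
  exact mul_le_mul_of_nonneg_right (ha i (by simpa [Nat.lt_succ_iff] using hi)) (abs_nonneg _)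

lemma sum_abs_coeff_mul_le (A B : PowerSeries ℤ) (N : ℕ) :
    ∑ n ∈ Finset.range (N + 1), |(A * B).coeff n| ≤
      (∑ j ∈ Finset.range (N + 1), |A.coeff j|) * ∑ j ∈ Finset.range (N + 1), |B.coeff j| := by
  rw [Finset.sum_mul_sum, ← Finset.sum_product']
  calc ∑ n ∈ Finset.range (N + 1), |(A * B).coeff n|
      ≤ ∑ n ∈ Finset.range (N + 1),
          ∑ x ∈ Finset.HasAntidiagonal.antidiagonal n, |A.coeff x.1| * |B.coeff x.2| := by
        refine Finset.sum_le_sum fun n _ => ?_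
        rw [PowerSeries.coeff_mul]
        refine (Finset.abs_sum_le_sum_abs _ _).trans_eq (Finset.sum_congr rfl fun i _ => abs_mul _ _)
    _ = ∑ x ∈ (Finset.range (N + 1)).biUnion Finset.HasAntidiagonal.antidiagonal,
          |A.coeff x.1| * |B.coeff x.2| := by
        rw [Finset.sum_biUnion]
        intro i _ j _ hij
        simp only [Function.onFun]
        rw [Finset.disjoint_left]
        intro x hx hx'
        rw [Finset.HasAntidiagonal.mem_antidiagonal] at hx hx'
        exact hij (hx.symm.trans hx')
    _ ≤ _ := by
        refine Finset.sum_le_sum_of_subset_of_nonneg ?_ fun _ _ _ => by positivity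
        intro x hx
        simp only [Finset.mem_biUnion, Finset.HasAntidiagonal.mem_antidiagonal, Finset.mem_range,
          Finset.mem_product] at hx ⊢
        omega

/-- One factor is estimated by its largest coefficient, the other three by their sums of absolute
values, each at most `m²`. -/
lemma abs_coeff_jacobiSeries_pow_four_le {N m : ℕ} (hm : 1 ≤ m) (h : 2 * N ≤ m ^ 2) :
    |(jacobiSeries ^ 4).coeff N| ≤ (2 * m - 1) * (m : ℤ) ^ 6 := by
  have hs : ∑ j ∈ Finset.range (N + 1), |jacobiSeries.coeff j| ≤ (m : ℤ) ^ 2 := by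
    simpa [jacobiSeries] using sum_abs_jacobiCoeff_le hm h
  have h0 : 0 ≤ ∑ j ∈ Finset.range (N + 1), |jacobiSeries.coeff j| :=
    Finset.sum_nonneg fun _ _ => abs_nonneg _
  have h3 : ∑ j ∈ Finset.range (N + 1), |(jacobiSeries * (jacobiSeries * jacobiSeries)).coeff j| ≤
      (m : ℤ) ^ 6 := by
    calc _ ≤ _ := sum_abs_coeff_mul_le _ _ _
      _ ≤ (m : ℤ) ^ 2 * ((m : ℤ) ^ 2 * (m : ℤ) ^ 2) := by
        refine mul_le_mul hs ((sum_abs_coeff_mul_le _ _ _).trans ?_)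
          (Finset.sum_nonneg fun _ _ => abs_nonneg _) (by positivity)
        exact mul_le_mul hs hs h0 (by positivity)
      _ = _ := by ring
  rw [show jacobiSeries ^ 4 = jacobiSeries * (jacobiSeries * (jacobiSeries * jacobiSeries)) by ring]
  refine (abs_coeff_mul_le _ _ (a := 2 * m - 1) fun i hi => ?_).trans ?_
  · simpa [jacobiSeries] using abs_jacobiCoeff_le hm (by omega)
  · exact mul_le_mul_of_nonneg_left h3 (by omega)

/-- The coefficients of `η(2z)¹² = ∑ τ(n) qⁿ`: `τ(2N + 1)` is the `N`-th coefficient of the fourth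
power of `∑ₖ (-1)ᵏ (2k+1) X^{k(k+1)/2}`, and all other coefficients vanish. -/
def tau (n : ℤ) : ℤ := if 0 < n ∧ n % 2 = 1 then (jacobiSeries ^ 4).coeff (n / 2).toNat else 0

lemma tau_of_nonpos {n : ℤ} (h : n ≤ 0) : tau n = 0 := if_neg fun h' => by omega

lemma tau_of_even {n : ℤ} (h : n % 2 = 0) : tau n = 0 := if_neg fun h' => by omega

lemma tau_odd (N : ℕ) : tau (2 * N + 1) = (jacobiSeries ^ 4).coeff N := by
  rw [tau, if_pos (by omega)]
  congr 2
  omega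

lemma abs_tau_le {n : ℤ} {m : ℕ} (hm : 1 ≤ m) (h : n ≤ (m : ℤ) ^ 2 + 1) :
    |tau n| ≤ 2 * (m : ℤ) ^ 7 := by
  by_cases hn : 0 < n ∧ n % 2 = 1
  · obtain ⟨N, rfl⟩ : ∃ N : ℕ, n = 2 * N + 1 := ⟨(n / 2).toNat, by omega⟩
    rw [tau_odd]
    have h2 : 2 * N ≤ m ^ 2 := by zify; linarith
    refine (abs_coeff_jacobiSeries_pow_four_le hm h2).trans ?_
    nlinarith [pow_nonneg (Int.natCast_nonneg m) 6]
  · rw [tau, if_neg hn, abs_zero]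
    positivity

/-! ### Explicit values of the coefficients -/

lemma coeff_mul_eq_of_values {A B : PowerSeries ℤ} {a b c : List ℤ} {M : ℕ}
    (ha : ∀ n < M, A.coeff n = a.getD n 0) (hb : ∀ n < M, B.coeff n = b.getD n 0)
    (hc : ∀ n < M, ∑ i ∈ Finset.range (n + 1), a.getD i 0 * b.getD (n - i) 0 = c.getD n 0) :
    ∀ n < M, (A * B).coeff n = c.getD n 0 := by
  intro n hn
  rw [← hc n hn, PowerSeries.coeff_mul, Finset.Nat.sum_antidiagonal_eq_sum_range_succ_mk]
  refine Finset.sum_congr rfl fun i hi => ?_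
  have := Finset.mem_range.mp hi
  rw [ha i (by omega), hb (n - i) (by omega)]

/-- The first coefficients of the fourth power of `jacobiSeries`. -/
def etaTwelveCoeffs : List ℤ :=
  [1, -12, 54, -88, -99, 540, -418, -648, 594, 836, 1056, -4104, -209, 4104, -594, 4256, -6480,
    -4752, -298, 5016, 17226, -12100, -5346, -1296, -9063, -7128, 19494, 29160, -10032, -7668,
    -34738, 8712, -22572]

/-- Indices up to 32 give `τ(n)` for `n ≤ 65 = 8² + 1`, which is what the terms `m ≤ 8` of the
series require. Squaring twice keeps the convolutions small. -/
lemma jacobiSeries_pow_four_values : ∀ n < 33, (jacobiSeries ^ 4).coeff n =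
    etaTwelveCoeffs.getD n 0 := by
  have h1 : ∀ n < 33, jacobiSeries.coeff n =
      ([1, -3, 0, 5, 0, 0, -7, 0, 0, 0, 9, 0, 0, 0, 0, -11, 0, 0, 0, 0, 0, 13, 0, 0, 0, 0, 0, 0, -15,
        0, 0, 0, 0] : List ℤ).getD n 0 := by
    simp only [jacobiSeries, PowerSeries.coeff_mk, jacobiCoeff]
    decide +kernel
  have h2 := coeff_mul_eq_of_values
    (c := [1, -6, 9, 10, -30, 0, 11, 42, 0, -70, 18, -54, 49, 90, 0, -22, -60, 0, -110,
      0, 81, 180, -78, 0, 130, -198, 0, -182, -30, 90, 121, 84, 0]) h1 h1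
    (by decide +kernel)
  rw [show jacobiSeries ^ 4 = (jacobiSeries * jacobiSeries) * (jacobiSeries * jacobiSeries) by ring]
  exact coeff_mul_eq_of_values h2 h2 (by decide +kernel)

/-! ### The function `η(z)¹²` -/

lemma summable_and_tsum_coeff_mul {A B : PowerSeries ℤ} {x : ℂ}
    (hA : Summable fun n => ‖(A.coeff n : ℂ) * x ^ n‖)
    (hB : Summable fun n => ‖(B.coeff n : ℂ) * x ^ n‖) :
    (Summable fun n => ‖((A * B).coeff n : ℂ) * x ^ n‖) ∧
    ∑' n, ((A * B).coeff n : ℂ) * x ^ n =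
      (∑' n, (A.coeff n : ℂ) * x ^ n) * ∑' n, (B.coeff n : ℂ) * x ^ n := by
  obtain ⟨f, hf⟩ : ∃ f : ℕ → ℂ, f = fun n => (A.coeff n : ℂ) * x ^ n := ⟨_, rfl⟩
  obtain ⟨g, hg⟩ : ∃ g : ℕ → ℂ, g = fun n => (B.coeff n : ℂ) * x ^ n := ⟨_, rfl⟩
  have key : (fun n => ((A * B).coeff n : ℂ) * x ^ n) =
      fun n => ∑ kl ∈ Finset.HasAntidiagonal.antidiagonal n, f kl.1 * g kl.2 := by
    funext n
    rw [PowerSeries.coeff_mul, Int.cast_sum, Finset.sum_mul]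
    refine Finset.sum_congr rfl fun kl hkl => ?_
    rw [← Finset.HasAntidiagonal.mem_antidiagonal.mp hkl, hf, hg]
    push_cast
    ring
  replace hA : Summable fun n => ‖f n‖ := by rw [hf]; exact hA
  replace hB : Summable fun n => ‖g n‖ := by rw [hg]; exact hB
  rw [← hf, ← hg, key, tsum_mul_tsum_eq_tsum_sum_antidiagonal_of_summable_norm hA hB]
  refine ⟨?_, rfl⟩
  have := summable_norm_sum_mul_antidiagonal_of_summable_norm hA hB
  exact this.congr fun n => by rw [← congrFun key n]

lemma summable_jacobiSeries {x : ℂ} (hx : ‖x‖ < 1) :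
    Summable fun n => ‖(jacobiSeries.coeff n : ℂ) * x ^ n‖ := by
  have h1 := summable_pow_mul_geometric_of_norm_lt_one 1 (r := ‖x‖) (by simpa using hx)
  have h0 := summable_geometric_of_lt_one (norm_nonneg x) hx
  refine Summable.of_nonneg_of_le (fun _ => norm_nonneg _) (fun n => ?_) ((h1.mul_left 4).add h0)
  have hb := abs_jacobiCoeff_le (j := n) (m := 2 * n + 1) (by omega) (by nlinarith)
  have hb' : |(jacobiCoeff n : ℝ)| ≤ 4 * n + 1 := by
    have : ((|jacobiCoeff n| : ℤ) : ℝ) ≤ ((2 * ((2 * n + 1 : ℕ) : ℤ) - 1 : ℤ) : ℝ) := by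
      exact_mod_cast hb
    push_cast at this
    linarith
  rw [norm_mul, norm_pow, jacobiSeries, PowerSeries.coeff_mk, Complex.norm_intCast]
  calc _ ≤ (4 * (n : ℝ) + 1) * ‖x‖ ^ n := by gcongr
    _ = _ := by ring

/-- The holomorphic function `∑ₖ (-1)ᵏ (2k+1) x^{k(k+1)/2}` on the unit disc. -/
def jacobiFun (x : ℂ) : ℂ := ∑' n, (jacobiSeries.coeff n : ℂ) * x ^ n

lemma hasSum_jacobiFun_pow_four {x : ℂ} (hx : ‖x‖ < 1) :
    HasSum (fun n => ((jacobiSeries ^ 4).coeff n : ℂ) * x ^ n) (jacobiFun x ^ 4) := by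
  have h1 := summable_jacobiSeries hx
  have h2 := summable_and_tsum_coeff_mul h1 h1
  have h4 := summable_and_tsum_coeff_mul h2.1 h2.1
  rw [show jacobiSeries ^ 4 = (jacobiSeries * jacobiSeries) * (jacobiSeries * jacobiSeries) by ring]
  convert! h4.1.of_norm.hasSum using 1
  rw [h4.2, h2.2, jacobiFun]
  ring

lemma differentiableAt_jacobiFun {x : ℂ} (hx : ‖x‖ < 1) : DifferentiableAt ℂ jacobiFun x := by
  obtain ⟨r, hr, hr1⟩ := exists_between hx
  have hr0 : 0 ≤ r := (norm_nonneg x).trans hr.le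
  have hs : Summable fun n => ‖(jacobiSeries.coeff n : ℂ) * (r : ℂ) ^ n‖ :=
    summable_jacobiSeries (by simpa [abs_of_nonneg hr0] using hr1)
  refine (Complex.differentiableOn_tsum_of_summable_norm (U := Metric.ball 0 r) hs
    (fun n => by fun_prop) Metric.isOpen_ball fun n w hw => ?_).differentiableAt
      (Metric.isOpen_ball.mem_nhds (by simpa using hr))
  rw [norm_mul, norm_mul, norm_pow, norm_pow, Complex.norm_real, Real.norm_of_nonneg hr0]
  have : ‖w‖ ≤ r := by simpa using (mem_ball_zero_iff.mp hw).le
  gcongr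

lemma jacobiFun_zero : jacobiFun 0 = 1 := by
  rw [jacobiFun, tsum_eq_single 0 (fun n hn => by simp [hn])]
  simp [jacobiSeries, jacobiCoeff]

lemma hasSum_jacobiFun_triangle {x : ℂ} (hx : ‖x‖ < 1) :
    HasSum (fun k : ℕ => ((-1) ^ k * (2 * k + 1) : ℂ) * x ^ (k * (k + 1) / 2)) (jacobiFun x) := by
  have htri : ∀ k : ℕ, k * (k + 1) = 2 * (k * (k + 1) / 2) := fun k =>
    (Nat.mul_div_cancel' (Nat.even_mul_succ_self k).two_dvd).symm
  have hinj : Function.Injective fun k : ℕ => k * (k + 1) / 2 := by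
    intro k l hkl
    exact triangle_inj (by rw [htri k, htri l]; exact congrArg _ hkl)
  have := (hinj.hasSum_iff (f := fun n => (jacobiSeries.coeff n : ℂ) * x ^ n)
    (a := jacobiFun x) fun n hn => ?_).mpr (summable_jacobiSeries hx).of_norm.hasSum
  · refine this.congr_fun ?_
    intro k
    simp only [Function.comp_apply, jacobiSeries, PowerSeries.coeff_mk]
    rw [jacobiCoeff_triangle (htri k)]
    push_cast
    ring
  · rw [jacobiSeries, PowerSeries.coeff_mk, jacobiCoeff_eq_zero]
    · simp
    · intro k hk
      exact hn ⟨k, by simp only; omega⟩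

lemma norm_cexp_two_pi_I_lt_one {z : ℂ} (hz : 0 < z.im) :
    ‖Complex.exp (2 * Real.pi * Complex.I * z)‖ < 1 := by
  rw [Complex.norm_exp, Real.exp_lt_one_iff]
  have : (2 * Real.pi * Complex.I * z).re = -(2 * Real.pi * z.im) := by
    simp [Complex.mul_re, Complex.mul_im]
  rw [this]
  have := Real.pi_pos
  exact neg_neg_of_pos (by positivity)

lemma jacobiTheta₂'_half {z : ℂ} (hz : 0 < z.im) :
    jacobiTheta₂' ((z + 1) / 2) z =
      2 * Real.pi * Complex.I * jacobiFun (Complex.exp (2 * Real.pi * Complex.I * z)) := by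
  set x := Complex.exp (2 * Real.pi * Complex.I * z) with hx
  have hs := ((hasSum_jacobiTheta₂'_term ((z + 1) / 2) hz)).nat_add_neg_add_one
  refine hs.unique ?_
  refine ((hasSum_jacobiFun_triangle (norm_cexp_two_pi_I_lt_one hz)).mul_left
    (2 * Real.pi * Complex.I)).congr_fun ?_
  -- The terms of index `k` and `-(k+1)` of the theta series carry the same power of `x`; their
  -- signs are opposite, and the derivative factors `k` and `-(k+1)` combine to `2k+1`.
  intro k
  have hk : ((k * (k + 1) / 2 : ℕ) : ℂ) = k * (k + 1) / 2 := by
    rw [Nat.cast_div (Nat.even_mul_succ_self k).two_dvd (by norm_num)]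
    push_cast
    ring
  have hsgn : Complex.exp (Real.pi * Complex.I * k) = (-1) ^ k := by
    rw [mul_comm, Complex.exp_nat_mul, Complex.exp_pi_mul_I]
  have hneg : Complex.exp (-(Real.pi * Complex.I * k)) = (-1) ^ k := by
    rw [Complex.exp_neg, hsgn, ← inv_pow]
    norm_num
  have e1 : jacobiTheta₂_term (k : ℤ) ((z + 1) / 2) z = (-1) ^ k * x ^ (k * (k + 1) / 2) := by
    rw [jacobiTheta₂_term, hx, ← Complex.exp_nat_mul, ← hsgn, ← Complex.exp_add, hk]
    congr 1
    push_cast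
    ring
  have e2 : jacobiTheta₂_term (-((k : ℤ) + 1)) ((z + 1) / 2) z =
      -((-1) ^ k * x ^ (k * (k + 1) / 2)) := by
    rw [jacobiTheta₂_term, hx, ← Complex.exp_nat_mul, ← hneg, ← Complex.exp_add, hk,
      ← Complex.exp_antiperiodic.sub_eq]
    congr 1
    push_cast
    ring
  rw [jacobiTheta₂'_term, jacobiTheta₂'_term, e1, e2]
  push_cast
  ring

/-- The function `η(z)¹²`, written as `e^{πiz} (∑ₖ (-1)ᵏ (2k+1) e^{πik(k+1)z})⁴`. -/
def etaTwelve (z : ℍ) : ℂ :=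
  Complex.exp (Real.pi * Complex.I * z) *
    jacobiFun (Complex.exp (2 * Real.pi * Complex.I * z)) ^ 4

lemma hasSum_etaTwelve (z : ℍ) :
    HasSum (fun n : ℕ => ((jacobiSeries ^ 4).coeff n : ℂ) *
      Complex.exp (Real.pi * Complex.I * z) ^ (2 * n + 1)) (etaTwelve z) := by
  have h := (hasSum_jacobiFun_pow_four (norm_cexp_two_pi_I_lt_one z.im_pos)).mul_left
    (Complex.exp (Real.pi * Complex.I * z))
  refine h.congr_fun fun n => ?_
  rw [pow_succ (Complex.exp _), pow_mul, ← Complex.exp_nat_mul _ 2]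
  push_cast
  rw [show (2 : ℂ) * (Real.pi * Complex.I * z) = 2 * Real.pi * Complex.I * z by ring]
  ring

lemma etaTwelve_vadd_one (z w : ℍ) (h : (w : ℂ) = z + 1) : etaTwelve w = -etaTwelve z := by
  rw [etaTwelve, etaTwelve, h]
  rw [show (Real.pi : ℂ) * Complex.I * (z + 1) = Real.pi * Complex.I * z + Real.pi * Complex.I by
    ring, show (2 : ℂ) * Real.pi * Complex.I * (z + 1) =
      2 * Real.pi * Complex.I * z + 2 * Real.pi * Complex.I by ring, Complex.exp_add,
      Complex.exp_pi_mul_I, Complex.exp_periodic]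
  ring

/-- Evenness and quasi-periodicity together give `θ = -θ` at the half period. This removes the
non-derivative term from the functional equation of `jacobiTheta₂'`. -/
lemma jacobiTheta₂_half (z : ℂ) : jacobiTheta₂ ((z + 1) / 2) z = 0 := by
  have h1 : jacobiTheta₂ (-((z + 1) / 2)) z = jacobiTheta₂ ((z + 1) / 2) z :=
    jacobiTheta₂_neg_left _ _
  have h2 := jacobiTheta₂_add_left' (-((z + 1) / 2)) z
  rw [← jacobiTheta₂_add_left, h1, show -((z + 1) / 2) + z + 1 = (z + 1) / 2 by ring,
    show -Real.pi * Complex.I * (z + 2 * -((z + 1) / 2)) = Real.pi * Complex.I by ring,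
    Complex.exp_pi_mul_I] at h2
  linear_combination h2 / 2

lemma etaTwelve_eq_jacobiTheta (z : ℍ) : etaTwelve z = Complex.exp (Real.pi * Complex.I * z) *
    (jacobiTheta₂' (((z : ℂ) + 1) / 2) z / (2 * Real.pi * Complex.I)) ^ 4 := by
  rw [jacobiTheta₂'_half z.im_pos, mul_div_cancel_left₀ _ Complex.two_pi_I_ne_zero, etaTwelve]

lemma etaTwelve_neg_inv (z w : ℍ) (h : (w : ℂ) = -1 / z) :
    etaTwelve w = -(z : ℂ) ^ 6 * etaTwelve z := by
  have hz : (z : ℂ) ≠ 0 := z.ne_zero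
  rw [etaTwelve_eq_jacobiTheta, etaTwelve_eq_jacobiTheta z]
  have harg : ((z : ℂ) + 1) / 2 / z = -(((w : ℂ) + 1) / 2) + 1 := by
    rw [h]
    field_simp
    ring
  -- The fourth power turns the square root of the theta transformation into a polynomial factor;
  -- with the factor `z⁴` it produces `-z⁶`.
  have hroot : ((-Complex.I * (z : ℂ)) ^ (1 / 2 : ℂ)) ^ 4 = -(z : ℂ) ^ 2 := by
    rw [← Complex.cpow_nat_mul]
    norm_num
    rw [mul_pow, Complex.I_sq]
    ring
  have hexp : Complex.exp (Real.pi * Complex.I * z) *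
      Complex.exp (-Real.pi * Complex.I * (((z : ℂ) + 1) / 2) ^ 2 / z) ^ 4 =
      Complex.exp (Real.pi * Complex.I * w) := by
    rw [← Complex.exp_nat_mul, ← Complex.exp_add, ← Complex.exp_periodic.sub_eq (Real.pi * Complex.I * w), h]
    congr 1
    field_simp
    push_cast
    ring
  have hz6 : (z : ℂ) ^ 6 ≠ 0 := pow_ne_zero _ hz
  rw [jacobiTheta₂'_functional_equation _ (z : ℂ), ← h, harg, jacobiTheta₂'_add_left,
    jacobiTheta₂_add_left, jacobiTheta₂'_neg_left, jacobiTheta₂_neg_left, jacobiTheta₂_half,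
    mul_zero, sub_zero, ← hexp]
  simp only [mul_pow, div_pow, hroot, one_pow]
  field_simp

lemma mdifferentiable_etaTwelve : MDiff etaTwelve := by
  rw [UpperHalfPlane.mdifferentiable_iff]
  have : DifferentiableOn ℂ (fun z : ℂ => Complex.exp (Real.pi * Complex.I * z) *
    jacobiFun (Complex.exp (2 * Real.pi * Complex.I * z)) ^ 4) {z | 0 < z.im} := by
    intro z hz
    refine DifferentiableAt.differentiableWithinAt ?_
    have h1 := (differentiableAt_jacobiFun (norm_cexp_two_pi_I_lt_one hz)).comp z
      (f := fun z => Complex.exp (2 * Real.pi * Complex.I * z)) (by fun_prop)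
    exact DifferentiableAt.mul (by fun_prop) (h1.pow 4)
  refine this.congr fun z hz => ?_
  simp [etaTwelve, ofComplex_apply_of_im_pos hz]

lemma tendsto_etaTwelve_div :
    Filter.Tendsto (fun z : ℍ => etaTwelve z / Complex.exp (Real.pi * Complex.I * z)) atImInfty
      (nhds 1) := by
  have h1 := (differentiableAt_jacobiFun (x := 0) (by simp)).continuousAt.pow 4
  have h2 := UpperHalfPlane.qParam_tendsto_atImInfty (h := 1) one_pos
  have h3 := h1.tendsto.comp h2
  simp only [Pi.pow_apply, jacobiFun_zero, one_pow] at h3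
  refine h3.congr fun z => ?_
  simp only [Function.comp_apply, Pi.pow_apply, qParam, Complex.ofReal_one,
    div_one, etaTwelve]
  rw [mul_div_cancel_left₀ _ (Complex.exp_ne_zero _)]

lemma norm_cexp_pi_I (z : ℍ) :
    ‖Complex.exp (Real.pi * Complex.I * z)‖ = Real.exp (-Real.pi * z.im) := by
  rw [Complex.norm_exp]
  congr 1
  simp [Complex.mul_re, Complex.mul_im]

lemma exp_isBigO_etaTwelve :
    (fun z : ℍ => Real.exp (-Real.pi * z.im)) =O[atImInfty] etaTwelve := by
  have h := tendsto_etaTwelve_div.norm.eventually (eventually_ge_nhds (b := 1 / 2) (by norm_num))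
  refine Asymptotics.IsBigO.of_bound 2 (h.mono fun z hz => ?_)
  rw [norm_div, norm_cexp_pi_I, le_div_iff₀ (Real.exp_pos _)] at hz
  rw [Real.norm_of_nonneg (Real.exp_pos _).le]
  linarith

lemma isZeroAtImInfty_etaTwelve : IsZeroAtImInfty etaTwelve := by
  have h : Filter.Tendsto (fun z : ℍ => Complex.exp (Real.pi * Complex.I * z)) atImInfty
      (nhds 0) := by
    have h2 := UpperHalfPlane.qParam_tendsto_atImInfty (h := 2) two_pos
    refine h2.congr fun z => ?_
    rw [qParam]
    congr 1
    push_cast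
    ring
  have := tendsto_etaTwelve_div.mul h
  rw [mul_zero] at this
  exact this.congr fun z => div_mul_cancel₀ _ (Complex.exp_ne_zero _)

lemma exists_etaTwelve_ne_zero : ∃ z, etaTwelve z ≠ 0 := by
  by_contra! h
  have := tendsto_etaTwelve_div
  simp only [h, zero_div] at this
  exact zero_ne_one (tendsto_nhds_unique tendsto_const_nhds this)

/-! ### Modularity of `η(z)¹²` -/

/-- The character of `SL(2, ℤ)` of order two: the sign of the permutation of `(ℤ/2)²` induced by a
matrix. -/
def signChar : SL(2, ℤ) →* ℤˣ :=
  (Equiv.Perm.sign.comp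
    (MulAction.toPermHom SL(2, ZMod 2) (Fin 2 → ZMod 2))).comp
    (Matrix.SpecialLinearGroup.map (Int.castRingHom (ZMod 2)))

lemma signChar_S : signChar ModularGroup.S = -1 := by
  decide +kernel

lemma signChar_T : signChar ModularGroup.T = -1 := by
  decide +kernel

lemma signChar_eq_of_map_eq {γ δ : SL(2, ℤ)} (h : ∀ i j, ((γ i j : ℤ) : ZMod 2) = (δ i j : ℤ)) :
    signChar γ = signChar δ := by
  have : Matrix.SpecialLinearGroup.map (Int.castRingHom (ZMod 2)) γ =
      Matrix.SpecialLinearGroup.map (Int.castRingHom (ZMod 2)) δ := by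
    ext i j
    simpa using h i j
  simp [signChar, this]

lemma signChar_of_mem_Gamma_two {γ : SL(2, ℤ)} (h : γ ∈ Gamma 2) : signChar γ = 1 := by
  have : Matrix.SpecialLinearGroup.map (Int.castRingHom (ZMod 2)) γ = 1 := h
  rw [signChar, MonoidHom.comp_apply, this, map_one]

lemma etaTwelve_slash_T : etaTwelve ∣[(6 : ℤ)] ModularGroup.T = -etaTwelve := by
  ext z
  rw [ModularForm.SL_slash_apply, UpperHalfPlane.modular_T_smul, Pi.neg_apply,
    etaTwelve_vadd_one z _ (by simp [add_comm])]
  rw [ModularGroup.denom_apply]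
  simp [ModularGroup.T]

lemma etaTwelve_slash_S : etaTwelve ∣[(6 : ℤ)] ModularGroup.S = -etaTwelve := by
  ext z
  have hz := z.ne_zero
  rw [ModularForm.SL_slash_apply, UpperHalfPlane.modular_S_smul, Pi.neg_apply,
    etaTwelve_neg_inv z _ (by simp [neg_div])]
  rw [ModularGroup.denom_S]
  simp only [zpow_neg]
  norm_cast
  field_simp

/-- A function that changes sign under the generators `S` and `T` transforms under `SL(2, ℤ)` by
the character `signChar`. -/
lemma slash_eq_signChar_smul {F : ℍ → ℂ} {k : ℤ} (hS : F ∣[k] ModularGroup.S = -F)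
    (hT : F ∣[k] ModularGroup.T = -F) (γ : SL(2, ℤ)) :
    F ∣[k] γ = ((signChar γ : ℤ) : ℂ) • F := by
  have hγ : γ ∈ Subgroup.closure {ModularGroup.S, ModularGroup.T} := by
    rw [SpecialLinearGroup.SL2Z_generators]; trivial
  induction hγ using Subgroup.closure_induction with
  | mem x hx =>
    rcases hx with rfl | rfl
    · simp [hS, signChar_S]
    · simp [hT, signChar_T]
  | one => simp
  | mul x y _ _ hx hy =>
    rw [SlashAction.slash_mul, hx, ModularForm.SL_smul_slash, hy, smul_smul, map_mul]
    push_cast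
    ring_nf
  | inv x _ hx =>
    have h1 : (F ∣[k] x) ∣[k] x⁻¹ = F := by rw [← SlashAction.slash_mul]; simp
    rw [hx, ModularForm.SL_smul_slash] at h1
    have hu : ((signChar x : ℤ) : ℂ) * ((signChar x : ℤ) : ℂ) = 1 := by
      rcases Int.units_eq_one_or (signChar x) with h | h <;> simp [h]
    rw [map_inv, Int.units_inv_eq_self, ← one_smul ℂ (F ∣[k] x⁻¹), ← hu, ← smul_smul, h1]

lemma etaTwelve_slash (γ : SL(2, ℤ)) :
    etaTwelve ∣[(6 : ℤ)] γ = ((signChar γ : ℤ) : ℂ) • etaTwelve :=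
  slash_eq_signChar_smul etaTwelve_slash_S etaTwelve_slash_T γ

lemma signChar_sq (γ : SL(2, ℤ)) : ((signChar γ : ℤ) : ℂ) * ((signChar γ : ℤ) : ℂ) = 1 := by
  rcases Int.units_eq_one_or (signChar γ) with h | h <;> simp [h]

lemma signChar_ne_zero (γ : SL(2, ℤ)) : ((signChar γ : ℤ) : ℂ) ≠ 0 := by
  intro h
  simpa [h] using signChar_sq γ

lemma IsZeroAtImInfty_const_smul {F : ℍ → ℂ} (hF : IsZeroAtImInfty F) (c : ℂ) :
    IsZeroAtImInfty (c • F) := by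
  have := Filter.Tendsto.const_mul c hF
  rw [mul_zero] at this
  exact this

/-- The square of `η(z)¹²`, as a cusp form of level one and weight twelve. -/
def etaTwelveSq : CuspForm 𝒮ℒ 12 where
  toFun := etaTwelve * etaTwelve
  slash_action_eq' := by
    rintro _ ⟨γ, rfl⟩
    change (etaTwelve * etaTwelve) ∣[(6 + 6 : ℤ)] γ = etaTwelve * etaTwelve
    rw [ModularForm.mul_slash_SL2, etaTwelve_slash, smul_mul_smul_comm, signChar_sq, one_smul]
  holo' := mdifferentiable_etaTwelve.mul mdifferentiable_etaTwelve
  zero_at_cusps' hc := by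
    rw [Subgroup.IsArithmetic.isCusp_iff_isCusp_SL2Z] at hc
    rw [OnePoint.isZeroAt_iff_forall_SL2Z hc]
    intro γ _
    change IsZeroAtImInfty ((etaTwelve * etaTwelve) ∣[(6 + 6 : ℤ)] γ)
    rw [ModularForm.mul_slash_SL2, etaTwelve_slash, smul_mul_smul_comm, signChar_sq, one_smul]
    have := Filter.Tendsto.mul isZeroAtImInfty_etaTwelve isZeroAtImInfty_etaTwelve
    rw [mul_zero] at this
    exact this

/-- The square is a nonzero multiple of the discriminant, which has no zeros on the upper
half-plane. -/
lemma etaTwelve_ne_zero (z : ℍ) : etaTwelve z ≠ 0 := by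
  obtain ⟨c, hc⟩ := CuspForm.exists_smul_discriminant_of_weight_eq_twelve etaTwelveSq
  have hc' : ∀ w, c * ModularForm.discriminant w = etaTwelve w * etaTwelve w := fun w =>
    DFunLike.congr_fun hc w
  obtain ⟨w, hw⟩ := exists_etaTwelve_ne_zero
  have hc0 : c ≠ 0 := by
    rintro rfl
    simpa [hw] using hc' w
  intro hz
  simpa [hz, hc0, ModularForm.discriminant_ne_zero] using hc' z

/-- A holomorphic function of weight six for `Γ(2)` that vanishes at all cusps is a multiple of
`η(z)¹²`. -/
lemma exists_eq_mul_etaTwelve {F : ℍ → ℂ} (hF : MDiff F)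
    (hinv : ∀ γ ∈ Gamma 2, F ∣[(6 : ℤ)] γ = F)
    (hzero : ∀ γ : SL(2, ℤ), IsZeroAtImInfty (F ∣[(6 : ℤ)] γ)) :
    ∃ c : ℂ, ∀ z, F z = c * etaTwelve z := by
  -- Every `SL(2, ℤ)`-translate of `F` is periodic with period 2 and vanishes at infinity, so it
  -- decays like `e^{-πy}`. This is exactly the decay of `η¹²`, hence the quotient stays bounded at
  -- every cusp.
  have hbig : ∀ γ : SL(2, ℤ), (F ∣[(6 : ℤ)] γ) =O[atImInfty] etaTwelve := by
    intro γ
    let G : SlashInvariantForm (Gamma 2 : Subgroup (GL (Fin 2) ℝ)) 6 :=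
      { toFun := F ∣[(6 : ℤ)] γ
        slash_action_eq' := by
          rintro _ ⟨δ, hδ, rfl⟩
          change (F ∣[(6 : ℤ)] γ) ∣[(6 : ℤ)] δ = F ∣[(6 : ℤ)] γ
          rw [← SlashAction.slash_mul, show γ * δ = (γ * δ * γ⁻¹) * γ by group,
            SlashAction.slash_mul, hinv _ ((Gamma_normal 2).conj_mem δ hδ γ)] }
    have hper : Function.Periodic ((F ∣[(6 : ℤ)] γ) ∘ ofComplex) (2 : ℝ) :=
      SlashInvariantFormClass.periodic_comp_ofComplex G (by simp)
    have hbdd : IsBoundedAtImInfty (F ∣[(6 : ℤ)] γ) := (hzero γ).isBigO_one ℝ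
    have := (hzero γ).exp_decay_atImInfty two_pos hper (hF.slash 6 _) hbdd
    refine Asymptotics.IsBigO.trans ?_ exp_isBigO_etaTwelve
    convert! this using 3
    ring
  have hslash : ∀ γ : SL(2, ℤ), (F / etaTwelve) ∣[(0 : ℤ)] γ =
      (F ∣[(6 : ℤ)] γ) / (((signChar γ : ℤ) : ℂ) • etaTwelve) := by
    intro γ
    rw [← etaTwelve_slash]
    exact ModularForm.div_slash_SL2 6 6 γ F etaTwelve
  let M : ModularForm (Gamma 2 : Subgroup (GL (Fin 2) ℝ)) 0 :=
    { toFun := F / etaTwelve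
      slash_action_eq' := by
        rintro _ ⟨γ, hγ, rfl⟩
        change (F / etaTwelve) ∣[(0 : ℤ)] γ = F / etaTwelve
        rw [hslash, hinv γ hγ, signChar_of_mem_Gamma_two hγ]
        simp
      holo' := hF.div mdifferentiable_etaTwelve etaTwelve_ne_zero
      bdd_at_cusps' := by
        intro c hc
        rw [Subgroup.IsArithmetic.isCusp_iff_isCusp_SL2Z] at hc
        rw [OnePoint.isBoundedAt_iff_forall_SL2Z hc]
        intro γ _
        rw [hslash]
        refine (Asymptotics.div_isBoundedUnder_of_isBigO ((hbig γ).trans ?_)).isBigO_one ℝ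
        exact Asymptotics.isBigO_self_const_mul (signChar_ne_zero γ) _ _ }
  obtain ⟨c, hc⟩ := ModularForm.eq_const_of_weight_zero M
  refine ⟨c, fun z => ?_⟩
  have : F z / etaTwelve z = c := congrFun hc z
  rw [← this, div_mul_cancel₀ _ (etaTwelve_ne_zero z)]

/-! ### The space `S_6(Γ₀(4))` -/

/-- The matrix `diag(a, d)` with positive integer entries. -/
def diagGL (a d : ℕ) [NeZero a] [NeZero d] : GL (Fin 2) ℚ :=
  Matrix.GeneralLinearGroup.mkOfDetNeZero !![(a : ℚ), 0; 0, (d : ℚ)] (by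
    simp [Matrix.det_fin_two, NeZero.ne])

/-- The matrix `diag(a, d)` as a real matrix. -/
def diagGLReal (a d : ℕ) [NeZero a] [NeZero d] : GL (Fin 2) ℝ :=
  (diagGL a d).map (Rat.castHom ℝ)

lemma coe_diagGLReal (a d : ℕ) [NeZero a] [NeZero d] :
    (diagGLReal a d : Matrix (Fin 2) (Fin 2) ℝ) = !![(a : ℝ), 0; 0, (d : ℝ)] := by
  ext i j
  fin_cases i <;> fin_cases j <;> simp [diagGLReal, diagGL, Matrix.GeneralLinearGroup.mkOfDetNeZero]

lemma det_diagGLReal (a d : ℕ) [NeZero a] [NeZero d] :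
    (diagGLReal a d).det.val = a * d := by
  rw [Matrix.GeneralLinearGroup.val_det_apply, coe_diagGLReal, Matrix.det_fin_two_of]
  ring

lemma det_diagGLReal_pos (a d : ℕ) [NeZero a] [NeZero d] : 0 < (diagGLReal a d).det.val := by
  rw [det_diagGLReal]
  have := NeZero.pos a
  have := NeZero.pos d
  positivity

lemma coe_diagGLReal_smul (a d : ℕ) [NeZero a] [NeZero d] (z : ℍ) :
    ((diagGLReal a d • z : ℍ) : ℂ) = a * z / d := by
  rw [UpperHalfPlane.coe_smul_of_det_pos (det_diagGLReal_pos a d)]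
  simp [num, denom, coe_diagGLReal]

lemma slash_diagGLReal (F : ℍ → ℂ) (a d : ℕ) [NeZero a] [NeZero d] (z : ℍ) :
    (F ∣[(6 : ℤ)] diagGLReal a d) z = (a : ℂ) ^ 5 / d * F (diagGLReal a d • z) := by
  have hd : (d : ℂ) ≠ 0 := by exact_mod_cast NeZero.ne d
  rw [ModularForm.slash_apply, det_diagGLReal, σ, if_pos (det_diagGLReal_pos a d)]
  have : denom (diagGLReal a d) z = d := by simp [denom, coe_diagGLReal]
  rw [this, abs_of_nonneg (by positivity)]
  have h5 : (((a : ℝ) * d : ℝ) : ℂ) ^ (6 - 1 : ℤ) = (a : ℂ) ^ 5 * (d : ℂ) ^ 5 := by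
    norm_num
    norm_cast
    ring
  have h6 : (d : ℂ) ^ (-6 : ℤ) = ((d : ℂ) ^ 6)⁻¹ := by
    rw [zpow_neg]; norm_cast
  rw [h5, h6]
  simp only [ContinuousAlgEquiv.refl_apply]
  field_simp

open ConjAct Pointwise in
lemma isCusp_smul {c : OnePoint ℝ} (hc : IsCusp c 𝒮ℒ) (g : GL (Fin 2) ℚ) :
    IsCusp (g.map (Rat.castHom ℝ) • c) 𝒮ℒ := by
  have h := hc.smul (g.map (Rat.castHom ℝ))
  have : (toConjAct (g.map (Rat.castHom ℝ)) • 𝒮ℒ).IsArithmetic := Subgroup.IsArithmetic.conj 𝒮ℒ g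
  rwa [Subgroup.IsArithmetic.isCusp_iff_isCusp_SL2Z] at h

lemma isCusp_smul_infty (γ : SL(2, ℤ)) :
    IsCusp (Matrix.SpecialLinearGroup.mapGL ℝ γ • (OnePoint.infty : OnePoint ℝ)) 𝒮ℒ :=
  isCusp_SL2Z_iff'.mpr ⟨γ, rfl⟩

lemma isZeroAt_etaTwelve {c : OnePoint ℝ} (hc : IsCusp c 𝒮ℒ) : c.IsZeroAt etaTwelve 6 := by
  rw [OnePoint.isZeroAt_iff_forall_SL2Z hc]
  intro γ _
  rw [etaTwelve_slash]
  exact IsZeroAtImInfty_const_smul isZeroAtImInfty_etaTwelve _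

/-- Conjugating by `diag(2, 1)`. -/
lemma etaTwelve_slash_diag_slash {γ δ : SL(2, ℤ)} (h00 : δ 0 0 = γ 0 0) (h01 : δ 0 1 = 2 * γ 0 1)
    (h10 : 2 * δ 1 0 = γ 1 0) (h11 : δ 1 1 = γ 1 1) :
    (etaTwelve ∣[(6 : ℤ)] diagGLReal 2 1) ∣[(6 : ℤ)] γ =
      ((signChar δ : ℤ) : ℂ) • (etaTwelve ∣[(6 : ℤ)] diagGLReal 2 1) := by
  have hmat : diagGLReal 2 1 * Matrix.SpecialLinearGroup.mapGL ℝ γ =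
      Matrix.SpecialLinearGroup.mapGL ℝ δ * diagGLReal 2 1 := by
    ext i j
    have h10' : (2 : ℝ) * (δ 1 0 : ℝ) = γ 1 0 := by exact_mod_cast h10
    fin_cases i <;> fin_cases j <;>
      simp [Matrix.mul_apply, coe_diagGLReal, h00, h01, h11, ← h10', mul_comm]
  change (etaTwelve ∣[(6 : ℤ)] diagGLReal 2 1) ∣[(6 : ℤ)] (Matrix.SpecialLinearGroup.mapGL ℝ γ) = _
  rw [← SlashAction.slash_mul, hmat, SlashAction.slash_mul]
  change (etaTwelve ∣[(6 : ℤ)] δ) ∣[(6 : ℤ)] _ = _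
  rw [etaTwelve_slash, ModularForm.smul_slash, σ, if_pos (det_diagGLReal_pos 2 1)]
  simp

lemma slash_diag_eq_levelRaise (F : ℍ → ℂ) :
    F ∣[(6 : ℤ)] diagGLReal 2 1 = (32 : ℂ) • levelRaise 2 F := by
  ext z
  rw [slash_diagGLReal, Pi.smul_apply, levelRaise]
  have : diagGLReal 2 1 • z = ofComplex (((2 : ℕ) : ℂ) * z) := by
    rw [← ofComplex_apply (diagGLReal 2 1 • z), coe_diagGLReal_smul]
    simp
  rw [this]
  norm_num

lemma levelRaise_etaTwelve_slash {γ δ : SL(2, ℤ)} (h00 : δ 0 0 = γ 0 0)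
    (h01 : δ 0 1 = 2 * γ 0 1) (h10 : 2 * δ 1 0 = γ 1 0) (h11 : δ 1 1 = γ 1 1) :
    levelRaise 2 etaTwelve ∣[(6 : ℤ)] γ =
      ((signChar δ : ℤ) : ℂ) • levelRaise 2 etaTwelve := by
  have := etaTwelve_slash_diag_slash h00 h01 h10 h11
  rw [slash_diag_eq_levelRaise, ModularForm.SL_smul_slash, smul_comm] at this
  exact smul_right_injective _ (by norm_num : (32 : ℂ) ≠ 0) this

/-- Conjugation by `diag(2, 1)` doubles the upper right entry and halves the lower left one. Both
become even, and the determinant then makes the diagonal odd. -/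
lemma exists_conj_of_mem_Gamma0_four {γ : SL(2, ℤ)} (hγ : γ ∈ Gamma0 4) :
    ∃ δ ∈ Gamma 2, δ 0 0 = γ 0 0 ∧ δ 0 1 = 2 * γ 0 1 ∧ 2 * δ 1 0 = γ 1 0 ∧ δ 1 1 = γ 1 1 := by
  rw [Gamma0_mem, ZMod.intCast_zmod_eq_zero_iff_dvd] at hγ
  obtain ⟨k, hk⟩ := hγ
  have hdet := γ.det_coe
  rw [Matrix.det_fin_two, hk] at hdet
  push_cast at hdet
  refine ⟨⟨!![γ 0 0, 2 * γ 0 1; 2 * k, γ 1 1], ?_⟩, ?_, rfl, rfl, ?_, rfl⟩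
  · rw [Matrix.det_fin_two_of]; linarith
  · have hodd : Odd (γ 0 0 * γ 1 1) := ⟨γ 0 1 * (2 * k), by linarith⟩
    rw [Int.odd_mul] at hodd
    have h2 : ((2 : ℤ) : ZMod 2) = 0 := by decide
    refine Gamma_mem.mpr ⟨?_, ?_, ?_, ?_⟩
    · exact ZMod.intCast_eq_one_iff_odd.mpr hodd.1
    · change ((2 * γ 0 1 : ℤ) : ZMod 2) = 0
      rw [Int.cast_mul, h2, zero_mul]
    · change ((2 * k : ℤ) : ZMod 2) = 0
      rw [Int.cast_mul, h2, zero_mul]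
    · exact ZMod.intCast_eq_one_iff_odd.mpr hodd.2
  · change 2 * (2 * k) = _
    rw [hk]
    push_cast
    ring

/-- The cusp form `η(2z)¹²` of weight six for `Γ₀(4)`. -/
def deltaFour : CuspSpace 4 6 where
  toFun := levelRaise 2 etaTwelve
  slash_action_eq' := by
    rintro _ ⟨γ, hγ, rfl⟩
    obtain ⟨δ, hδ, h00, h01, h10, h11⟩ := exists_conj_of_mem_Gamma0_four hγ
    change levelRaise 2 etaTwelve ∣[(6 : ℤ)] γ = _
    rw [levelRaise_etaTwelve_slash h00 h01 h10 h11, signChar_of_mem_Gamma_two hδ]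
    simp
  holo' := by
    have h := mdifferentiable_etaTwelve.slash 6 (diagGLReal 2 1)
    rw [slash_diag_eq_levelRaise] at h
    have := h.const_smul ((32 : ℂ)⁻¹)
    simpa [smul_smul] using this
  zero_at_cusps' := by
    intro c hc
    rw [Subgroup.IsArithmetic.isCusp_iff_isCusp_SL2Z] at hc
    have h := OnePoint.IsZeroAt.smul_iff.mp (isZeroAt_etaTwelve (isCusp_smul hc (diagGL 2 1)))
    change c.IsZeroAt (etaTwelve ∣[(6 : ℤ)] diagGLReal 2 1) 6 at h
    rw [slash_diag_eq_levelRaise] at h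
    rw [OnePoint.isZeroAt_iff_forall_SL2Z hc] at h ⊢
    intro γ hγ
    have := IsZeroAtImInfty_const_smul (h γ hγ) (32 : ℂ)⁻¹
    rwa [ModularForm.SL_smul_slash, smul_smul, inv_mul_cancel₀ (by norm_num), one_smul] at this

lemma deltaFour_apply (z : ℍ) : deltaFour z = etaTwelve (ofComplex (2 * (z : ℂ))) := rfl

lemma exists_eq_smul_deltaFour (f : CuspSpace 4 6) : ∃ c : ℂ, f = c • deltaFour := by
  -- The inverse conjugation: up to a constant the slashed function is `f(z/2)`, which is therefore
  -- invariant under `Γ(2)`.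
  have hinv : ∀ γ ∈ Gamma 2, ((f : ℍ → ℂ) ∣[(6 : ℤ)] diagGLReal 1 2) ∣[(6 : ℤ)] γ =
      (f : ℍ → ℂ) ∣[(6 : ℤ)] diagGLReal 1 2 := by
    intro γ hγ
    rw [Gamma_mem] at hγ
    obtain ⟨-, h01, h10, -⟩ := hγ
    rw [ZMod.intCast_zmod_eq_zero_iff_dvd] at h01 h10
    obtain ⟨b, hb⟩ := h01
    obtain ⟨d, hd⟩ := h10
    have hdet := γ.det_coe
    rw [Matrix.det_fin_two, hb] at hdet
    push_cast at hdet hb hd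
    let δ : SL(2, ℤ) := ⟨!![γ 0 0, b; 2 * γ 1 0, γ 1 1], by
      rw [Matrix.det_fin_two_of]; linarith⟩
    have hδ : δ ∈ Gamma0 4 := by
      rw [Gamma0_mem, ZMod.intCast_zmod_eq_zero_iff_dvd]
      exact ⟨d, by change 2 * γ 1 0 = _; rw [hd]; push_cast; ring⟩
    obtain ⟨e00, e01, e10, e11⟩ : δ 0 0 = γ 0 0 ∧ δ 0 1 = b ∧ δ 1 0 = 2 * γ 1 0 ∧ δ 1 1 = γ 1 1 :=
      ⟨rfl, rfl, rfl, rfl⟩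
    clear_value δ
    have hmem : Matrix.SpecialLinearGroup.mapGL ℝ δ ∈
      ((Gamma0 4 : Subgroup SL(2, ℤ)) : Subgroup (GL (Fin 2) ℝ)) := ⟨δ, hδ, rfl⟩
    have hmat : diagGLReal 1 2 * Matrix.SpecialLinearGroup.mapGL ℝ γ =
        Matrix.SpecialLinearGroup.mapGL ℝ δ * diagGLReal 1 2 := by
      ext i j
      fin_cases i <;> fin_cases j <;>
        simp [Matrix.mul_apply, coe_diagGLReal, hb, e00, e01, e10, e11, mul_comm]
    change ((f : ℍ → ℂ) ∣[(6 : ℤ)] diagGLReal 1 2) ∣[(6 : ℤ)] (Matrix.SpecialLinearGroup.mapGL ℝ γ) = _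
    rw [← SlashAction.slash_mul, hmat, SlashAction.slash_mul,
      SlashInvariantForm.slash_action_eqn f _ hmem]
  have hzero : ∀ γ : SL(2, ℤ), IsZeroAtImInfty (((f : ℍ → ℂ) ∣[(6 : ℤ)] diagGLReal 1 2) ∣[(6 : ℤ)] γ) := by
    intro γ
    change IsZeroAtImInfty (((f : ℍ → ℂ) ∣[(6 : ℤ)] diagGLReal 1 2) ∣[(6 : ℤ)]
      (Matrix.SpecialLinearGroup.mapGL ℝ γ))
    have hc := isCusp_smul (isCusp_smul_infty γ) (diagGL 1 2)
    have h := CuspFormClass.zero_at_cusps f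
      ((Subgroup.IsArithmetic.isCusp_iff_isCusp_SL2Z _).mpr hc)
    exact OnePoint.IsZeroAt.smul_iff.mp h _ rfl
  obtain ⟨c, hc⟩ := exists_eq_mul_etaTwelve (F := (f : ℍ → ℂ) ∣[(6 : ℤ)] diagGLReal 1 2)
    ((CuspFormClass.holo f).slash 6 _) hinv hzero
  -- The slash by `diag(1, 2)` is `f(z/2) / 2`, whence the factor 2.
  refine ⟨2 * c, CuspForm.ext fun z => ?_⟩
  have h := hc (ofComplex (2 * (z : ℂ)))
  have hz2 : 0 < (2 * (z : ℂ)).im := by simpa using z.im_pos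
  rw [slash_diagGLReal] at h
  have : diagGLReal 1 2 • ofComplex (2 * (z : ℂ)) = z := by
    apply UpperHalfPlane.ext
    rw [coe_diagGLReal_smul, ofComplex_apply_of_im_pos hz2]
    simp
  rw [this] at h
  change f z = (2 * c) * deltaFour z
  rw [deltaFour_apply]
  push_cast at h
  linear_combination 2 * h

lemma levelRaise_etaTwelve_ne_zero (z : ℍ) : deltaFour z ≠ 0 := etaTwelve_ne_zero _

lemma deltaFour_ne_zero : deltaFour ≠ 0 := fun h =>
  levelRaise_etaTwelve_ne_zero I (by rw [h]; rfl)

lemma finrank_cuspSpace_four_six : Module.finrank ℂ (CuspSpace 4 6) = 1 :=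
  (finrank_eq_one_iff_of_nonzero' _ deltaFour_ne_zero).mpr fun f =>
    let ⟨c, hc⟩ := exists_eq_smul_deltaFour f
    ⟨c, hc.symm⟩

/-! ### Absence of oldforms -/

/-- Such a form is also of level 4, hence a multiple of `η(2z)¹²`. The matrix with rows `(1, 0)` and
`(2, 1)` fixes it but changes the sign of `η(2z)¹²`. -/
lemma cuspSpace_eq_zero_of_dvd_two {M : ℕ} (hM : M ∣ 2) (g : CuspSpace M 6) : (g : ℍ → ℂ) = 0 := by
  have : NeZero M := ⟨by rintro rfl; simp at hM⟩
  have hle : Gamma0 4 ≤ Gamma0 M := by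
    intro γ hγ
    rw [Gamma0_mem, ZMod.intCast_zmod_eq_zero_iff_dvd] at hγ ⊢
    exact dvd_trans (by exact_mod_cast hM.trans (by norm_num : 2 ∣ 4)) hγ
  let g' : CuspSpace 4 6 :=
    { toFun := g
      slash_action_eq' := by
        rintro _ ⟨γ, hγ, rfl⟩
        exact SlashInvariantForm.slash_action_eqn g _ ⟨γ, hle hγ, rfl⟩
      holo' := CuspFormClass.holo g
      zero_at_cusps' := fun hc => CuspFormClass.zero_at_cusps g
        (hc.mono (Subgroup.map_mono hle)) }
  obtain ⟨c, hc⟩ := exists_eq_smul_deltaFour g'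
  have hg : (g : ℍ → ℂ) = c • levelRaise 2 etaTwelve := congrArg DFunLike.coe hc
  let γ : SL(2, ℤ) := ⟨!![1, 0; 2, 1], by simp⟩
  let δ : SL(2, ℤ) := ⟨!![1, 0; 1, 1], by simp⟩
  have hγ : γ ∈ Gamma0 M := by
    rw [Gamma0_mem, ZMod.intCast_zmod_eq_zero_iff_dvd]
    change (M : ℤ) ∣ 2
    exact_mod_cast hM
  have hδ : signChar δ = -1 := by decide +kernel
  have h1 : (g : ℍ → ℂ) ∣[(6 : ℤ)] γ = g :=
    SlashInvariantForm.slash_action_eqn g _ ⟨γ, hγ, rfl⟩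
  have h2 : levelRaise 2 etaTwelve ∣[(6 : ℤ)] γ = -levelRaise 2 etaTwelve := by
    rw [levelRaise_etaTwelve_slash (γ := γ) (δ := δ) rfl rfl rfl rfl, hδ]
    simp
  rw [hg, ModularForm.SL_smul_slash, h2, smul_neg, neg_eq_self] at h1
  rw [hg, h1]

lemma isNew_of_cuspSpace_four_six (f : CuspSpace 4 6) : IsNew f := by
  intro M d hM hMd g
  have hM2 : M ∣ 2 := by
    have h4 : M ∣ 4 := (Dvd.intro _ rfl).trans hMd
    have : M ≤ 4 := Nat.le_of_dvd (by norm_num) h4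
    interval_cases M <;> simp_all
  have : levelRaise d g = 0 := by
    ext z
    simp [levelRaise, cuspSpace_eq_zero_of_dvd_two hM2 g]
  simp [peterssonProduct, petersson, this]

/-! ### Hecke operators -/

/-- `η(z)¹²` as a function on `ℂ`. -/
def etaTwelveC (z : ℂ) : ℂ := etaTwelve (ofComplex z)

lemma etaTwelveC_add_one {z : ℂ} (hz : 0 < z.im) : etaTwelveC (z + 1) = -etaTwelveC z := by
  refine etaTwelve_vadd_one _ _ ?_
  rw [ofComplex_apply_of_im_pos hz, ofComplex_apply_of_im_pos (by simpa using hz)]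

lemma etaTwelveC_add_two {z : ℂ} (hz : 0 < z.im) : etaTwelveC (z + 2) = etaTwelveC z := by
  rw [show z + 2 = z + 1 + 1 by ring, etaTwelveC_add_one (by simpa using hz),
    etaTwelveC_add_one hz, neg_neg]

lemma etaTwelveC_add_two_mul {z : ℂ} (hz : 0 < z.im) (k : ℤ) :
    etaTwelveC (z + 2 * k) = etaTwelveC z := by
  have step : ∀ k : ℤ, etaTwelveC (z + 2 * (k + 1 : ℤ)) = etaTwelveC (z + 2 * k) := by
    intro k
    rw [← etaTwelveC_add_two (z := z + 2 * k) (by simpa using hz)]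
    congr 1
    push_cast
    ring
  induction k using Int.induction_on with
  | zero => simp
  | succ n ih => rw [step, ih]
  | pred n ih => rw [← ih, ← step, sub_add_cancel]

lemma im_neg_inv_pos {z : ℂ} (hz : 0 < z.im) : 0 < (-1 / z).im := by
  rw [neg_div, one_div, Complex.neg_im, Complex.inv_im, neg_div, neg_neg]
  have : z ≠ 0 := by rintro rfl; simp at hz
  exact div_pos hz (Complex.normSq_pos.mpr this)

lemma etaTwelveC_neg_inv {z : ℂ} (hz : 0 < z.im) :
    etaTwelveC (-1 / z) = -z ^ 6 * etaTwelveC z := by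
  have := etaTwelve_neg_inv (ofComplex z) (ofComplex (-1 / z)) ?_
  · have h2 : ((ofComplex z : ℍ) : ℂ) = z := by rw [ofComplex_apply_of_im_pos hz]
    rwa [h2] at this
  · rw [ofComplex_apply_of_im_pos hz, ofComplex_apply_of_im_pos (im_neg_inv_pos hz)]

lemma etaTwelveC_moebius (γ : SL(2, ℤ)) {z : ℂ} (hz : 0 < z.im) :
    etaTwelveC ((γ 0 0 * z + γ 0 1) / (γ 1 0 * z + γ 1 1)) =
      ((signChar γ : ℤ) : ℂ) * (γ 1 0 * z + γ 1 1) ^ 6 * etaTwelveC z := by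
  have h := congrFun (etaTwelve_slash γ) (ofComplex z)
  have hd : denom γ (ofComplex z) ≠ 0 := denom_ne_zero _ _
  rw [ModularForm.SL_slash_apply, Pi.smul_apply, smul_eq_mul, zpow_neg,
    mul_inv_eq_iff_eq_mul₀ (zpow_ne_zero _ hd)] at h
  rw [ModularGroup.denom_apply, ofComplex_apply_of_im_pos hz] at h
  have h2 : ofComplex ((γ 0 0 * z + γ 0 1) / (γ 1 0 * z + γ 1 1)) = γ • (⟨z, hz⟩ : ℍ) := by
    rw [← ofComplex_apply (γ • (⟨z, hz⟩ : ℍ)), UpperHalfPlane.specialLinearGroup_apply]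
    simp
  have h3 : etaTwelveC z = etaTwelve ⟨z, hz⟩ := by
    rw [etaTwelveC, ofComplex_apply_of_im_pos hz]
  rw [etaTwelveC, h2, h, h3]
  norm_cast
  ring

lemma differentiableAt_etaTwelveC {z : ℂ} (hz : 0 < z.im) : DifferentiableAt ℂ etaTwelveC z :=
  UpperHalfPlane.mdifferentiableAt_iff.mp (mdifferentiable_etaTwelve ⟨z, hz⟩)

lemma im_affine {a b : ℝ} (w : ℂ) : ((a : ℂ) * w + b).im = a * w.im := by
  simp

lemma tendsto_etaTwelveC_affine {a : ℝ} (ha : 0 < a) (b : ℝ) :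
    Filter.Tendsto (fun w : ℍ => etaTwelveC (a * w + b)) atImInfty (nhds 0) := by
  refine Filter.Tendsto.comp (g := etaTwelve) isZeroAtImInfty_etaTwelve ?_
  rw [atImInfty, Filter.tendsto_comap_iff]
  refine (Filter.tendsto_comap.const_mul_atTop ha).congr fun w => ?_
  have h : 0 < ((a : ℂ) * w + b).im := by rw [im_affine]; exact mul_pos ha w.im_pos
  rw [Function.comp_apply, ← coe_im, ofComplex_apply_of_im_pos h]
  exact (im_affine (w : ℂ)).symm

/-- The Hecke operator `T_p`, for odd `p`, on `η¹²`, with `ℤ/p` as set of indices. -/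
def heckeEta (p : ℕ) [NeZero p] (w : ℂ) : ℂ :=
  (p : ℂ) ^ 5 * etaTwelveC (p * w) +
    (p : ℂ)⁻¹ * ∑ j : ZMod p, etaTwelveC ((w + 2 * (j.val : ℂ)) / p)

section
variable {p : ℕ} [NeZero p]

lemma im_add_div_pos {w : ℂ} (hw : 0 < w.im) (m : ℤ) : 0 < ((w + 2 * (m : ℂ)) / p).im := by
  rw [Complex.div_natCast_im]
  have : 0 < (p : ℝ) := by exact_mod_cast NeZero.pos p
  simpa using div_pos hw this

lemma im_natCast_mul_pos {w : ℂ} (hw : 0 < w.im) : 0 < ((p : ℂ) * w).im := by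
  have : 0 < (p : ℝ) := by exact_mod_cast NeZero.pos p
  simpa using mul_pos this hw

/-- Since `η¹²` has period 2, the summand depends only on the class of the index modulo `p`. -/
lemma etaTwelveC_val {w : ℂ} (hw : 0 < w.im) (m : ℤ) :
    etaTwelveC ((w + 2 * (((m : ZMod p).val : ℕ) : ℂ)) / p) = etaTwelveC ((w + 2 * (m : ℂ)) / p) := by
  have hp : (p : ℂ) ≠ 0 := by exact_mod_cast NeZero.ne p
  rw [← etaTwelveC_add_two_mul (im_add_div_pos hw m) (-(m / p))]
  congr 1
  have h1 : (((m : ZMod p).val : ℕ) : ℤ) = m % p := ZMod.val_intCast m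
  have h2 : (((m : ZMod p).val : ℕ) : ℤ) = m - p * (m / p) := by
    rw [h1]; linarith [Int.emod_add_mul_ediv m p]
  have h3 : (((m : ZMod p).val : ℕ) : ℂ) = m - p * ((m / p : ℤ) : ℂ) := by exact_mod_cast h2
  rw [h3]
  field_simp
  push_cast
  ring

lemma heckeEta_add_one (hp : Odd p) {w : ℂ} (hw : 0 < w.im) :
    heckeEta p (w + 1) = -heckeEta p w := by
  have hp0 : (p : ℂ) ≠ 0 := by exact_mod_cast NeZero.ne p
  obtain ⟨q, hq⟩ := hp
  have hqc : (p : ℂ) = 2 * q + 1 := by exact_mod_cast hq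
  have h1 : etaTwelveC (p * (w + 1)) = -etaTwelveC (p * w) := by
    have := im_natCast_mul_pos (p := p) hw
    rw [← etaTwelveC_add_one this, ← etaTwelveC_add_two_mul (z := p * w + 1) (by simpa using this) q]
    congr 1
    push_cast
    linear_combination hqc
  -- With `p = 2q + 1`, adding 1 to `(w + 1 + 2j)/p` gives `(w + 2(j + q + 1))/p`: a sign and a
  -- shift of the index by `q + 1`.
  have h2 : ∀ j : ZMod p, etaTwelveC ((w + 1 + 2 * (j.val : ℂ)) / p) =
      -etaTwelveC ((w + 2 * ((j + ((q + 1 : ℕ) : ZMod p)).val : ℂ)) / p) := by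
    intro j
    have hj : j + ((q + 1 : ℕ) : ZMod p) = (((j.val : ℤ) + (q + 1) : ℤ) : ZMod p) := by simp
    have hw1 : 0 < (w + 1).im := by simpa using hw
    rw [hj, etaTwelveC_val hw, eq_neg_iff_add_eq_zero, add_comm, ← eq_neg_iff_add_eq_zero,
      ← etaTwelveC_add_one (by simpa using im_add_div_pos (p := p) hw1 j.val)]
    congr 1
    field_simp
    push_cast
    linear_combination -hqc
  have h3 := Equiv.sum_comp (Equiv.addRight ((q + 1 : ℕ) : ZMod p))
    fun j : ZMod p => etaTwelveC ((w + 2 * (j.val : ℂ)) / p)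
  simp only [Equiv.coe_addRight] at h3
  rw [heckeEta, heckeEta, h1, Finset.sum_congr rfl fun j _ => h2 j, Finset.sum_neg_distrib, h3]
  ring

end

lemma etaTwelveC_neg_inv_add {p : ℕ} [Fact p.Prime] (hp : p ≠ 2) {w : ℂ} (hw : 0 < w.im)
    {j : ZMod p} (hj : j ≠ 0) :
    etaTwelveC ((-1 / w + 2 * (j.val : ℂ)) / p) =
      -w ^ 6 * etaTwelveC ((w + 2 * (((-(4 * j)⁻¹ : ZMod p).val : ℕ) : ℂ)) / p) := by
  have hp0 : (p : ℂ) ≠ 0 := by exact_mod_cast (NeZero.ne p)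
  have hw0 : w ≠ 0 := by rintro rfl; simp at hw
  have hodd : Odd p := (Fact.out : p.Prime).odd_of_ne_two hp
  have h2 : (2 : ZMod p) ≠ 0 := by
    intro h
    have : ((2 : ℕ) : ZMod p) = 0 := by exact_mod_cast h
    rw [ZMod.natCast_eq_zero_iff] at this
    exact hp ((Nat.prime_dvd_prime_iff_eq Fact.out Nat.prime_two).mp this)
  have h4 : (4 * j : ZMod p) ≠ 0 := by
    rw [show (4 : ZMod p) = 2 * 2 by norm_num]
    exact mul_ne_zero (mul_ne_zero h2 h2) hj
  set a : ℕ := j.val with ha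
  set b : ℕ := (-(4 * j)⁻¹ : ZMod p).val with hb
  have hab : ((4 * a * b + 1 : ℤ) : ZMod p) = 0 := by
    push_cast
    rw [ha, hb, ZMod.natCast_zmod_val, ZMod.natCast_zmod_val, mul_neg, mul_inv_cancel₀ h4,
      neg_add_cancel]
  rw [ZMod.intCast_zmod_eq_zero_iff_dvd] at hab
  obtain ⟨c, hc⟩ := hab
  -- The relation `4ab + 1 = pc` makes the determinant 1. This matrix sends `(w + 2b)/p` to `(-1/w +
  -- 2a)/p` with automorphy factor `w`, and it is congruent to `S` modulo 2.
  let γ : SL(2, ℤ) := ⟨!![2 * a, -c; p, -2 * b], by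
    rw [Matrix.det_fin_two_of]; linarith⟩
  have hsign : signChar γ = -1 := by
    have hcodd : Odd c := by
      have : Odd ((p : ℤ) * c) := ⟨2 * a * b, by linarith⟩
      exact (Int.odd_mul.mp this).2
    rw [← signChar_S]
    have e2 : ((2 : ℤ) : ZMod 2) = 0 := by decide
    have e1 : ((-1 : ℤ) : ZMod 2) = 1 := by decide
    have ec : (c : ZMod 2) = 1 := ZMod.intCast_eq_one_iff_odd.mpr hcodd
    have ep : ((p : ℤ) : ZMod 2) = 1 :=
      ZMod.intCast_eq_one_iff_odd.mpr (by exact_mod_cast hodd)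
    apply signChar_eq_of_map_eq
    intro i k
    fin_cases i <;> fin_cases k
    · change ((2 * a : ℤ) : ZMod 2) = ((0 : ℤ) : ZMod 2)
      rw [Int.cast_mul, e2, zero_mul, Int.cast_zero]
    · change ((-c : ℤ) : ZMod 2) = ((-1 : ℤ) : ZMod 2)
      rw [Int.cast_neg, ec]; decide
    · change ((p : ℤ) : ZMod 2) = ((1 : ℤ) : ZMod 2)
      rw [ep, Int.cast_one]
    · change ((-2 * b : ℤ) : ZMod 2) = ((0 : ℤ) : ZMod 2)
      rw [neg_mul, Int.cast_neg, Int.cast_mul, e2, zero_mul, neg_zero, Int.cast_zero]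
  have hz : 0 < ((w + 2 * (b : ℂ)) / p).im := by exact_mod_cast im_add_div_pos (p := p) hw b
  have h := etaTwelveC_moebius γ hz
  have e00 : ((γ 0 0 : ℤ) : ℂ) = 2 * a := by
    change ((2 * a : ℤ) : ℂ) = _; push_cast; rfl
  have e01 : ((γ 0 1 : ℤ) : ℂ) = -c := by
    change ((-c : ℤ) : ℂ) = _; push_cast; rfl
  have e10 : ((γ 1 0 : ℤ) : ℂ) = p := by
    change ((p : ℤ) : ℂ) = _; push_cast; rfl
  have e11 : ((γ 1 1 : ℤ) : ℂ) = -2 * b := by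
    change ((-2 * b : ℤ) : ℂ) = _; push_cast; rfl
  have hcC : (4 * a * b + 1 : ℂ) = p * c := by exact_mod_cast hc
  have hden : (p : ℂ) * ((w + 2 * b) / p) + -2 * b = w := by field_simp; ring
  rw [e00, e01, e10, e11, hden, hsign] at h
  have hnum : (2 * a * ((w + 2 * b) / p) + -c) / w = (-1 / w + 2 * (a : ℂ)) / p := by
    field_simp
    linear_combination hcC
  rw [hnum] at h
  rw [h]
  push_cast
  ring

/-- Inversion exchanges the term at `pw` with the term `j = 0`, and permutes the remaining terms by
the involution `j ↦ -1/(4j)` of the nonzero residues. -/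
lemma heckeEta_neg_inv {p : ℕ} [Fact p.Prime] (hp : p ≠ 2) {w : ℂ} (hw : 0 < w.im) :
    heckeEta p (-1 / w) = -w ^ 6 * heckeEta p w := by
  have hp0 : (p : ℂ) ≠ 0 := by exact_mod_cast (NeZero.ne p)
  have hw0 : w ≠ 0 := by rintro rfl; simp at hw
  have hinv : ∀ j : ZMod p, -(4 * -(4 * j)⁻¹)⁻¹ = j := by
    have h2 : (2 : ZMod p) ≠ 0 := by
      intro h
      have : ((2 : ℕ) : ZMod p) = 0 := by exact_mod_cast h
      rw [ZMod.natCast_eq_zero_iff] at this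
      exact hp ((Nat.prime_dvd_prime_iff_eq Fact.out Nat.prime_two).mp this)
    have h4 : (4 : ZMod p) ≠ 0 := by
      rw [show (4 : ZMod p) = 2 * 2 by norm_num]
      exact mul_ne_zero h2 h2
    intro j
    rw [mul_neg, inv_neg, neg_neg, mul_inv, inv_inv, inv_mul_cancel_left₀ h4]
  have hp1 : etaTwelveC (p * (-1 / w)) = -(w / p) ^ 6 * etaTwelveC (w / p) := by
    rw [← etaTwelveC_neg_inv (by simpa using im_add_div_pos (p := p) hw 0)]
    congr 1
    field_simp
  have hp2 : etaTwelveC (-1 / w / p) = -(p * w) ^ 6 * etaTwelveC (p * w) := by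
    rw [← etaTwelveC_neg_inv (im_natCast_mul_pos hw)]
    congr 1
    field_simp
  have hsum : ∑ j ∈ Finset.univ.erase (0 : ZMod p), etaTwelveC ((-1 / w + 2 * (j.val : ℂ)) / p) =
      -w ^ 6 * ∑ j ∈ Finset.univ.erase (0 : ZMod p), etaTwelveC ((w + 2 * (j.val : ℂ)) / p) := by
    rw [Finset.mul_sum]
    have hne : ∀ j : ZMod p, j ≠ 0 → -(4 * j)⁻¹ ≠ 0 := by
      intro j hj h0
      have := hinv j
      rw [h0] at this
      simp at this
      exact hj this.symm
    refine Finset.sum_nbij' (fun j => -(4 * j)⁻¹) (fun j => -(4 * j)⁻¹) ?_ ?_ ?_ ?_ ?_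
    · intro j hj
      simpa using hne j (by simpa using hj)
    · intro j hj
      simpa using hne j (by simpa using hj)
    · exact fun j _ => hinv j
    · exact fun j _ => hinv j
    · exact fun j hj => etaTwelveC_neg_inv_add hp hw (by simpa using hj)
  rw [heckeEta, heckeEta, ← Finset.add_sum_erase _ _ (Finset.mem_univ (0 : ZMod p)), hsum,
    ← Finset.add_sum_erase _ (fun j : ZMod p => etaTwelveC ((w + 2 * (j.val : ℂ)) / p))
      (Finset.mem_univ (0 : ZMod p)), hp1]
  simp only [ZMod.val_zero, Nat.cast_zero, mul_zero, add_zero, hp2]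
  field_simp
  ring

lemma exists_heckeEta_eq {p : ℕ} [Fact p.Prime] (hp : p ≠ 2) :
    ∃ c : ℂ, ∀ z : ℍ, heckeEta p z = c * etaTwelve z := by
  have hodd : Odd p := (Fact.out : p.Prime).odd_of_ne_two hp
  have hp0 : 0 < (p : ℝ) := by exact_mod_cast NeZero.pos p
  set F : ℍ → ℂ := fun z => heckeEta p z with hF
  have hT : F ∣[(6 : ℤ)] ModularGroup.T = -F := by
    ext z
    have h : ((ModularGroup.T • z : ℍ) : ℂ) = z + 1 := by
      rw [UpperHalfPlane.modular_T_smul]; simp [add_comm]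
    rw [ModularForm.SL_slash_apply, Pi.neg_apply, hF]
    simp only
    rw [h, heckeEta_add_one hodd z.im_pos, ModularGroup.denom_apply]
    simp [ModularGroup.T]
  have hS : F ∣[(6 : ℤ)] ModularGroup.S = -F := by
    ext z
    have hz := z.ne_zero
    have h : ((ModularGroup.S • z : ℍ) : ℂ) = -1 / z := by
      rw [UpperHalfPlane.modular_S_smul]; simp [neg_div]
    rw [ModularForm.SL_slash_apply, Pi.neg_apply, hF]
    simp only
    rw [h, heckeEta_neg_inv hp z.im_pos, ModularGroup.denom_S]
    simp only [zpow_neg]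
    norm_cast
    field_simp
  have hslash := slash_eq_signChar_smul hS hT
  have hhol : MDiff F := by
    rw [UpperHalfPlane.mdifferentiable_iff]
    have : DifferentiableOn ℂ (heckeEta p) {z | 0 < z.im} := by
      intro z hz
      refine DifferentiableAt.differentiableWithinAt ?_
      refine DifferentiableAt.add ?_ ?_
      · exact ((differentiableAt_etaTwelveC (im_natCast_mul_pos hz)).comp z
          (f := fun w => (p : ℂ) * w) (by fun_prop)).const_mul _
      · refine (DifferentiableAt.fun_sum fun j _ => ?_).const_mul _
        exact (differentiableAt_etaTwelveC
          (by exact_mod_cast im_add_div_pos (p := p) hz j.val)).comp z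
          (f := fun w => (w + 2 * (j.val : ℂ)) / p) (by fun_prop)
    refine this.congr fun z hz => ?_
    simp [hF, ofComplex_apply_of_im_pos hz]
  have hzero : IsZeroAtImInfty F := by
    have h1 : Filter.Tendsto (fun z : ℍ => etaTwelveC (p * z)) atImInfty (nhds 0) := by
      simpa using tendsto_etaTwelveC_affine hp0 0
    have h2 : ∀ j : ZMod p, Filter.Tendsto (fun z : ℍ => etaTwelveC ((z + 2 * (j.val : ℂ)) / p))
        atImInfty (nhds 0) := by
      intro j
      refine (tendsto_etaTwelveC_affine (inv_pos.mpr hp0) (2 * j.val / p)).congr fun z => ?_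
      congr 1
      push_cast
      ring
    have h3 := (h1.const_mul ((p : ℂ) ^ 5)).add
      ((tendsto_finsetSum Finset.univ fun j _ => h2 j).const_mul (p : ℂ)⁻¹)
    simp only [Finset.sum_const_zero, mul_zero, add_zero] at h3
    exact h3
  refine exists_eq_mul_etaTwelve hhol (fun γ hγ => ?_) fun γ => ?_
  · rw [hslash, signChar_of_mem_Gamma_two hγ]
    simp only [Units.val_one, Int.cast_one, one_smul, hF]
  · rw [hslash]
    exact IsZeroAtImInfty_const_smul hzero _

lemma heckeT_deltaFour {p : ℕ} (hp : p.Prime) :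
    ∃ c : ℂ, ∀ z : ℍ, heckeT 4 6 p deltaFour z = c * deltaFour z := by
  have hdel : ∀ z : ℂ, 0 < z.im → deltaFour (ofComplex z) = etaTwelveC (2 * z) := by
    intro z hz
    rw [deltaFour_apply, ofComplex_apply_of_im_pos hz]
    rfl
  have hdel' : ∀ z : ℍ, deltaFour z = etaTwelveC (2 * z) := fun z => rfl
  rcases eq_or_ne p 2 with rfl | hp2
  -- The two summands of `U_2` are `η¹²(z)` and `η¹²(z + 1)`, which cancel; the eigenvalue is 0.
  · refine ⟨0, fun z => ?_⟩
    have h1 : ∀ j : ℕ, deltaFour (ofComplex (((z : ℂ) + (j : ℂ)) / (2 : ℕ))) =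
        etaTwelveC (z + j) := by
      intro j
      rw [hdel]
      · congr 1
        push_cast
        ring
      · rw [Complex.div_natCast_im]
        simpa using z.im_pos
    have h2 : etaTwelveC ((z : ℂ) + 1) = -etaTwelveC z := etaTwelveC_add_one z.im_pos
    simp only [heckeT, h1, Finset.sum_range_succ, Finset.sum_range_zero]
    norm_num [h2]
  · have : Fact p.Prime := ⟨hp⟩
    have hp0 : (p : ℂ) ≠ 0 := by exact_mod_cast (NeZero.ne p)
    obtain ⟨c, hc⟩ := exists_heckeEta_eq hp2
    refine ⟨c, fun z => ?_⟩
    have hz2 : 0 < (2 * (z : ℂ)).im := by simpa using z.im_pos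
    have h := hc (ofComplex (2 * (z : ℂ)))
    have hndvd : ¬ p ∣ 4 := by
      intro h4
      rw [show 4 = 2 ^ 2 by norm_num] at h4
      exact hp2 ((Nat.prime_dvd_prime_iff_eq hp Nat.prime_two).mp (hp.dvd_of_dvd_pow h4))
    have h1 : ∀ j : ℕ, deltaFour (ofComplex (((z : ℂ) + (j : ℂ)) / p)) =
        etaTwelveC ((2 * z + 2 * j) / p) := by
      intro j
      rw [hdel]
      · congr 1
        ring
      · rw [Complex.div_natCast_im]
        have : 0 < (p : ℝ) := by exact_mod_cast NeZero.pos p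
        simpa using div_pos z.im_pos this
    have h0 : levelRaise p deltaFour z = etaTwelveC (p * (2 * z)) := by
      rw [levelRaise, hdel _ (im_natCast_mul_pos z.im_pos)]
      congr 1
      ring
    rw [deltaFour_apply, ← h, heckeT, if_neg hndvd, h0, heckeEta, ofComplex_apply_of_im_pos hz2]
    congr 2
    refine Finset.sum_nbij' (fun j => (j : ZMod p)) ZMod.val ?_ ?_ ?_ ?_ ?_
    · simp
    · intro j _
      simpa using ZMod.val_lt j
    · intro j hj
      exact ZMod.val_cast_of_lt (Finset.mem_range.mp hj)
    · simp
    · intro j hj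
      rw [h1, ZMod.val_cast_of_lt (Finset.mem_range.mp hj)]

/-! ### Fourier coefficients -/

lemma fourierCoeff_natCast (f : ℍ → ℂ) (n : ℕ) : fourierCoeff f n = (qExpansion 1 f).coeff n := by
  simp [fourierCoeff]

lemma qParam_one_eq (z : ℍ) : qParam 1 (z : ℂ) = Complex.exp (2 * Real.pi * Complex.I * z) := by
  simp [qParam]

lemma hasSum_deltaFour (z : ℍ) :
    HasSum (fun m : ℕ => (tau m : ℂ) • qParam 1 (z : ℂ) ^ m) (deltaFour z) := by
  have hz2 : 0 < (2 * (z : ℂ)).im := by simpa using z.im_pos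
  have h := hasSum_etaTwelve (ofComplex (2 * (z : ℂ)))
  rw [← deltaFour_apply, ofComplex_apply_of_im_pos hz2] at h
  have hinj : Function.Injective fun n : ℕ => 2 * n + 1 := fun a b hab => by
    simp only at hab; omega
  refine (hinj.hasSum_iff fun m hm => ?_).mp (h.congr_fun fun n => ?_)
  · have : (m : ℤ) % 2 = 0 := by
      by_contra h'
      exact hm ⟨m / 2, by simp only; omega⟩
    rw [tau_of_even this, Int.cast_zero, zero_smul]
  · simp only [Function.comp_apply]
    rw [qParam_one_eq, smul_eq_mul]
    push_cast
    rw [tau_odd]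
    congr 3
    ring

lemma one_mem_strictPeriods_Gamma0 (N : ℕ) :
    (1 : ℝ) ∈ ((Gamma0 N : Subgroup SL(2, ℤ)) : Subgroup (GL (Fin 2) ℝ)).strictPeriods := by
  simp

lemma fourierCoeff_deltaFour (n : ℤ) : fourierCoeff deltaFour n = tau n := by
  by_cases hn : 0 ≤ n
  · lift n to ℕ using hn
    rw [fourierCoeff_natCast]
    exact (ModularFormClass.qExpansion_coeff_unique one_pos (one_mem_strictPeriods_Gamma0 4)
      hasSum_deltaFour n).symm
  · rw [fourierCoeff, if_neg hn, tau_of_nonpos (by omega), Int.cast_zero]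

lemma tau_one : tau 1 = 1 := by
  have := tau_odd 0
  simpa [etaTwelveCoeffs, jacobiSeries_pow_four_values 0 (by norm_num)] using this

lemma isNewform_deltaFour : IsNewform deltaFour :=
  ⟨isNew_of_cuspSpace_four_six _, fun _ hp => heckeT_deltaFour hp, by
    rw [fourierCoeff_deltaFour, tau_one, Int.cast_one]⟩

lemma fourierCoeff_smul (c : ℂ) (f : CuspSpace 4 6) (n : ℕ) :
    fourierCoeff (c • f : CuspSpace 4 6) n = c * fourierCoeff f n := by
  rw [fourierCoeff_natCast, fourierCoeff_natCast]
  have := ModularForm.qExpansion_smul one_pos (one_mem_strictPeriods_Gamma0 4) c f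
  change (qExpansion 1 (c • (f : ℍ → ℂ))).coeff n = _
  rw [this]
  simp

lemma eq_deltaFour_of_isNewform {f : CuspSpace 4 6} (hf : IsNewform f) : f = deltaFour := by
  obtain ⟨c, rfl⟩ := exists_eq_smul_deltaFour f
  have h := hf.2.2
  have h1 := fourierCoeff_smul c deltaFour 1
  rw [Nat.cast_one, h, fourierCoeff_deltaFour, tau_one, Int.cast_one, mul_one] at h1
  rw [← h1, one_smul]

/-! ### The theta series and its product with a cusp form -/

/-- The coefficients of the theta series. -/
def thetaCoeff (m : ℕ) : ℤ := (if IsSquare m then 2 else 0) - if m = 0 then 1 else 0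

lemma hasSum_theta (z : ℍ) :
    HasSum (fun m : ℕ => (thetaCoeff m : ℂ) • qParam 1 (z : ℂ) ^ m) (theta z) := by
  have hz2 : 0 < (2 * (z : ℂ)).im := by simpa using z.im_pos
  have h := (hasSum_jacobiTheta₂_term 0 hz2).summable
  have hterm : ∀ n : ℤ, jacobiTheta₂_term n 0 (2 * z) =
      Complex.exp (2 * Real.pi * Complex.I * (n : ℂ) ^ 2 * (z : ℂ)) := by
    intro n
    rw [jacobiTheta₂_term]
    congr 1
    ring
  have h1 : HasSum (fun n : ℤ => Complex.exp (2 * Real.pi * Complex.I * (n : ℂ) ^ 2 * (z : ℂ)))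
      (theta z) := (h.congr fun n => hterm n).hasSum
  have h2 := h1.nat_add_neg
  have hinj : Function.Injective fun n : ℕ => n * n := fun a b hab => Nat.mul_self_inj.mp hab
  -- Pairing `n` with `-n` counts `n = 0` twice, so the sum is `θ + 1`; the series `h4` removes the
  -- excess.
  have h3 : HasSum (fun m : ℕ => ((if IsSquare m then 2 else 0 : ℤ) : ℂ) • qParam 1 (z : ℂ) ^ m)
      (theta z + 1) := by
    refine (hinj.hasSum_iff fun m hm => ?_).mp ?_
    · rw [if_neg, Int.cast_zero, zero_smul]
      rintro ⟨r, hr⟩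
      exact hm ⟨r, hr.symm⟩
    · convert! h2 using 1
      · ext n
        simp only [Function.comp_apply]
        rw [if_pos ⟨n, rfl⟩, qParam_one_eq, ← Complex.exp_nat_mul]
        push_cast
        rw [neg_sq, smul_eq_mul, ← two_mul]
        congr 2
        ring
      · simp
  have h4 : HasSum (fun m : ℕ => ((if m = 0 then 1 else 0 : ℤ) : ℂ) • qParam 1 (z : ℂ) ^ m) 1 := by
    convert! hasSum_single (f := fun m : ℕ => ((if m = 0 then 1 else 0 : ℤ) : ℂ) •
      qParam 1 (z : ℂ) ^ m) 0 (fun m hm => by simp [hm]) using 1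
    simp
  have h5 := h3.sub h4
  rw [add_sub_cancel_right] at h5
  refine h5.congr_fun fun m => ?_
  rw [thetaCoeff, Int.cast_sub, sub_smul]

lemma theta_eq_jacobiTheta₂ (z : ℍ) : theta z = jacobiTheta₂ 0 (2 * z) := by
  rw [theta, jacobiTheta₂]
  refine tsum_congr fun n => ?_
  rw [jacobiTheta₂_term]
  congr 1
  ring

lemma mdifferentiable_theta : MDiff theta := by
  rw [UpperHalfPlane.mdifferentiable_iff]
  have : DifferentiableOn ℂ (fun z => jacobiTheta₂ 0 (2 * z)) {z | 0 < z.im} := by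
    intro z hz
    have hz2 : 0 < (2 * z).im := by simpa using hz
    exact ((differentiableAt_jacobiTheta₂_snd 0 hz2).comp z
      (f := fun z => 2 * z) (by fun_prop)).differentiableWithinAt
  refine this.congr fun z hz => ?_
  rw [Function.comp_apply, theta_eq_jacobiTheta₂, ofComplex_apply_of_im_pos hz]

lemma periodic_theta : Function.Periodic (theta ∘ ofComplex) (1 : ℝ) := by
  intro w
  by_cases hw : 0 < w.im
  · have hw1 : 0 < (w + (1 : ℝ)).im := by simpa using hw
    have h1 := hasSum_theta (ofComplex w)
    have h2 := hasSum_theta (ofComplex (w + (1 : ℝ)))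
    have hq : qParam 1 ((ofComplex (w + (1 : ℝ)) : ℍ) : ℂ) = qParam 1 ((ofComplex w : ℍ) : ℂ) := by
      rw [qParam_one_eq, qParam_one_eq, ofComplex_apply_of_im_pos hw, ofComplex_apply_of_im_pos hw1]
      simp only [Complex.ofReal_one, mul_add, mul_one]
      exact Complex.exp_periodic _
    rw [hq] at h2
    exact h2.unique h1
  -- Off the upper half-plane `ofComplex` takes a fixed default value, so periodicity holds there
  -- too.
  · have hw1 : (w + (1 : ℝ)).im ≤ 0 := by simpa using hw
    simp only [Function.comp_apply]
    rw [ofComplex_apply_of_im_nonpos hw1, ofComplex_apply_of_im_nonpos (not_lt.mp hw)]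

lemma analyticAt_cuspFunction_theta : AnalyticAt ℂ (cuspFunction 1 theta) 0 :=
  analyticAt_cuspFunction_zero one_pos periodic_theta mdifferentiable_theta
    (isBoundedAtImInfty_of_hasSum_qExpansion one_pos hasSum_theta)

lemma fourierCoeff_theta (n : ℕ) : fourierCoeff theta n = thetaCoeff n := by
  rw [fourierCoeff_natCast]
  have h1 := (hasFPowerSeriesOnBall_cuspFunction one_pos analyticAt_cuspFunction_theta
    hasSum_theta).hasFPowerSeriesAt
  have h2 := h1.eq_formalMultilinearSeries analyticAt_cuspFunction_theta.hasFPowerSeriesAt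
  have h3 := congrArg (FormalMultilinearSeries.coeff · n) h2
  simp only [FormalMultilinearSeries.coeff_ofScalars] at h3
  rw [h3, qExpansion_coeff, inv_mul_eq_div]

lemma fourierCoeff_theta_mul (f : CuspSpace 4 6) (n : ℕ) :
    fourierCoeff (fun z => theta z * f z) n =
      ∑ r ∈ Finset.range (n + 1), fourierCoeff theta r * fourierCoeff f ((n : ℤ) - (r : ℤ)) := by
  have h := qExpansion_mul analyticAt_cuspFunction_theta
    (ModularFormClass.analyticAt_cuspFunction_zero f one_pos (one_mem_strictPeriods_Gamma0 4))
  change fourierCoeff (theta * ⇑f) n = _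
  rw [fourierCoeff_natCast, h, PowerSeries.coeff_mul,
    Finset.Nat.sum_antidiagonal_eq_sum_range_succ_mk]
  refine Finset.sum_congr rfl fun r hr => ?_
  have hr' : r ≤ n := Nat.lt_succ_iff.mp (Finset.mem_range.mp hr)
  rw [← Nat.cast_sub hr', fourierCoeff_natCast, fourierCoeff_natCast]

/-! ### Positivity of the series -/

/-- The sum `∑_{0 ≤ s ≤ m} τ(m² + 1 - s²)`. -/
def shiftedSum (m : ℕ) : ℤ := ∑ s ∈ Finset.range (m + 1), tau ((m : ℤ) ^ 2 + 1 - (s : ℤ) ^ 2)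

lemma sum_Icc_neg_eq (m : ℕ) :
    ∑ r ∈ Finset.Icc (-(m : ℤ)) m, tau ((m : ℤ) ^ 2 + 1 - r ^ 2) =
      2 * shiftedSum m - tau ((m : ℤ) ^ 2 + 1) := by
  have := Finset.sum_Icc_of_even_eq_range (f := fun r : ℤ => tau ((m : ℤ) ^ 2 + 1 - r ^ 2))
    (fun r => by simp) m
  rw [this, shiftedSum]
  simp

/-- For `r > m ≥ 1` the argument `m² + 1 - r²` is at most 0, so these terms vanish; the subtracted
value is the term `s = 0`. -/
lemma sum_Icc_one_eq {m : ℕ} (hm : 1 ≤ m) :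
    ∑ r ∈ Finset.Icc (1 : ℤ) ((m : ℤ) ^ 2 + 1), tau ((m : ℤ) ^ 2 + 1 - r ^ 2) =
      shiftedSum m - tau ((m : ℤ) ^ 2 + 1) := by
  have h1 : ∑ r ∈ Finset.Icc (1 : ℤ) ((m : ℤ) ^ 2 + 1), tau ((m : ℤ) ^ 2 + 1 - r ^ 2) =
      ∑ r ∈ Finset.Icc (1 : ℤ) m, tau ((m : ℤ) ^ 2 + 1 - r ^ 2) := by
    symm
    refine Finset.sum_subset (fun r hr => ?_) fun r hr hr' => tau_of_nonpos ?_
    · rw [Finset.mem_Icc] at hr ⊢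
      exact ⟨hr.1, by nlinarith⟩
    · rw [Finset.mem_Icc] at hr hr'
      have : (m : ℤ) + 1 ≤ r := by
        by_contra h
        exact hr' ⟨hr.1, by omega⟩
      have hm' : (1 : ℤ) ≤ m := by exact_mod_cast hm
      nlinarith
  rw [h1, shiftedSum, Finset.sum_range_succ', eq_sub_iff_add_eq]
  congr 1
  · refine Finset.sum_nbij' (fun r => (r - 1).toNat) (fun s => (s : ℤ) + 1) ?_ ?_ ?_ ?_ ?_
    · intro r hr
      rw [Finset.mem_Icc] at hr
      rw [Finset.mem_range]
      omega
    · intro s hs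
      rw [Finset.mem_range] at hs
      rw [Finset.mem_Icc]
      omega
    · intro r hr
      rw [Finset.mem_Icc] at hr
      omega
    · intro s _
      simp
    · intro r hr
      rw [Finset.mem_Icc] at hr
      congr 3
      push_cast
      omega

lemma sum_thetaCoeff_mul_tau {m : ℕ} (hm : 1 ≤ m) :
    ∑ r ∈ Finset.range (m ^ 2 + 1 + 1), thetaCoeff r * tau ((m ^ 2 + 1 : ℕ) - (r : ℤ)) =
      2 * shiftedSum m - tau ((m : ℤ) ^ 2 + 1) := by
  simp only [thetaCoeff, sub_mul, Finset.sum_sub_distrib]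
  congr 1
  · rw [shiftedSum, Finset.mul_sum]
    simp only [ite_mul, zero_mul]
    rw [← Finset.sum_filter]
    symm
    refine Finset.sum_nbij (fun s => s * s) ?_ ?_ ?_ ?_
    · intro s hs
      rw [Finset.mem_range] at hs
      rw [Finset.mem_filter, Finset.mem_range]
      exact ⟨by nlinarith, s, rfl⟩
    · exact fun a _ b _ hab => Nat.mul_self_inj.mp hab
    · intro r hr
      rw [Finset.mem_coe, Finset.mem_filter, Finset.mem_range] at hr
      obtain ⟨hr, s, rfl⟩ := hr
      refine ⟨s, ?_, rfl⟩
      rw [Finset.mem_coe, Finset.mem_range]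
      by_contra h
      push Not at h
      nlinarith
    · intro s _
      push_cast
      ring_nf
  · simp

lemma tau_eq_getD {n : ℤ} (hn : n ≤ 65) : tau n = if 0 < n ∧ n % 2 = 1 then
    etaTwelveCoeffs.getD (n / 2).toNat 0 else 0 := by
  rw [tau]
  split_ifs with h
  · exact jacobiSeries_pow_four_values _ (by omega)
  · rfl

lemma shiftedSum_values : ∀ m ∈ Finset.range 9, shiftedSum m =
    ([1, 1, 55, -98, 177, 386, -5721, 7955, -66966] : List ℤ).getD m 0 := by
  have h : ∀ m ∈ Finset.range 9, shiftedSum m = ∑ s ∈ Finset.range (m + 1),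
      if 0 < (m : ℤ) ^ 2 + 1 - (s : ℤ) ^ 2 ∧ ((m : ℤ) ^ 2 + 1 - (s : ℤ) ^ 2) % 2 = 1 then
      etaTwelveCoeffs.getD
        (((m : ℤ) ^ 2 + 1 - (s : ℤ) ^ 2) / 2).toNat 0 else 0 := by
    intro m hm
    refine Finset.sum_congr rfl fun s _ => tau_eq_getD ?_
    have : m ≤ 8 := by simpa [Nat.lt_succ_iff] using hm
    have : (m : ℤ) ≤ 8 := by exact_mod_cast this
    nlinarith
  intro m hm
  rw [h m hm]
  revert m
  decide +kernel

lemma abs_shiftedSum_sub_le {m : ℕ} (hm : 1 ≤ m) :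
    |shiftedSum m - tau ((m : ℤ) ^ 2 + 1)| ≤ 2 * (m : ℤ) ^ 8 := by
  rw [shiftedSum, Finset.sum_range_succ']
  have : ∀ s ∈ Finset.range m, |tau ((m : ℤ) ^ 2 + 1 - ((s + 1 : ℕ) : ℤ) ^ 2)| ≤ 2 * (m : ℤ) ^ 7 :=
    fun s _ => abs_tau_le hm (by nlinarith [sq_nonneg ((s + 1 : ℕ) : ℤ)])
  calc _ = |∑ s ∈ Finset.range m, tau ((m : ℤ) ^ 2 + 1 - ((s + 1 : ℕ) : ℤ) ^ 2)| := by simp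
    _ ≤ ∑ s ∈ Finset.range m, |tau ((m : ℤ) ^ 2 + 1 - ((s + 1 : ℕ) : ℤ) ^ 2)| :=
        Finset.abs_sum_le_sum_abs _ _
    _ ≤ ∑ s ∈ Finset.range m, 2 * (m : ℤ) ^ 7 := Finset.sum_le_sum this
    _ = 2 * (m : ℤ) ^ 8 := by simp; ring

/-- The constant 6 is `2·2 + 2`: twice the previous bound, plus one further value of `τ`. -/
lemma abs_two_mul_shiftedSum_sub_le {m : ℕ} (hm : 1 ≤ m) :
    |2 * shiftedSum m - tau ((m : ℤ) ^ 2 + 1)| ≤ 6 * (m : ℤ) ^ 8 := by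
  have h1 := abs_shiftedSum_sub_le hm
  have h2 : |tau ((m : ℤ) ^ 2 + 1)| ≤ 2 * (m : ℤ) ^ 7 := abs_tau_le hm le_rfl
  have h3 : (m : ℤ) ^ 7 ≤ (m : ℤ) ^ 8 :=
    pow_le_pow_right₀ (by exact_mod_cast hm) (by norm_num)
  rw [abs_le] at h1 h2 ⊢
  constructor <;> linarith

/-! ### Numerical estimates and the tail -/

/-- The general term of the series, as a real number. -/
def seriesTerm (u : ℕ → ℤ) (m : ℕ) : ℝ := (u m : ℝ) / (((m : ℝ) ^ 2 + 1) ^ (11 / 2 : ℝ) : ℝ)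

lemma pow_mul_le_rpow {m : ℕ} :
    (((m : ℝ) ^ 2 + 1) ^ 5 * m : ℝ) ≤ ((m : ℝ) ^ 2 + 1) ^ (11 / 2 : ℝ) := by
  have hx : (0 : ℝ) < (m : ℝ) ^ 2 + 1 := by positivity
  rw [show (11 / 2 : ℝ) = ((5 : ℕ) : ℝ) + 1 / 2 by norm_num, Real.rpow_add hx, Real.rpow_natCast,
    ← Real.sqrt_eq_rpow]
  gcongr
  exact Real.le_sqrt_of_sq_le (by linarith)

/-- Positive terms are discarded, and in the negative ones the half-integral power is replaced by a
smaller rational denominator, which leaves a bound computable exactly. -/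
lemma seriesTerm_ge {u : ℕ → ℤ} {m : ℕ} (hm : 1 ≤ m) :
    -((max 0 (-u m) : ℤ) : ℝ) / (((m : ℝ) ^ 2 + 1) ^ 5 * m) ≤ seriesTerm u m := by
  have hm0 : (0 : ℝ) < m := by exact_mod_cast hm
  have hd : (0 : ℝ) < ((m : ℝ) ^ 2 + 1) ^ 5 * m := by positivity
  have hx : (0 : ℝ) < ((m : ℝ) ^ 2 + 1) ^ (11 / 2 : ℝ) := by positivity
  rw [seriesTerm]
  rcases le_total 0 (u m) with h | h
  · rw [max_eq_left (by omega)]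
    have : (0 : ℝ) ≤ u m := by exact_mod_cast h
    simp only [Int.cast_zero, neg_zero, zero_div]
    positivity
  · rw [max_eq_right (by omega)]
    have h0 : (u m : ℝ) ≤ 0 := by exact_mod_cast h
    push_cast
    rw [neg_neg, div_le_div_iff₀ hd hx]
    exact mul_le_mul_of_nonpos_left pow_mul_le_rpow h0

lemma abs_seriesTerm_le {u : ℕ → ℤ} {K : ℕ} (hu : ∀ m : ℕ, 1 ≤ m → |u m| ≤ K * (m : ℤ) ^ 8)
    (i : ℕ) :
    |seriesTerm u (i + 9)| ≤ K * (1 / (2 * ((i : ℝ) + 8) * (i + 9)) -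
      1 / (2 * (((i + 1 : ℕ) : ℝ) + 8) * ((i + 1 : ℕ) + 9))) := by
  have h1 := hu (i + 9) (by omega)
  have h2 : |(u (i + 9) : ℝ)| ≤ K * ((i : ℝ) + 9) ^ 8 := by exact_mod_cast h1
  have hpos : (0 : ℝ) < ((((i + 9 : ℕ) : ℝ)) ^ 2 + 1) ^ 5 * ((i + 9 : ℕ) : ℝ) := by positivity
  rw [seriesTerm, abs_div, abs_of_pos (Real.rpow_pos_of_pos (by positivity) _)]
  set x : ℝ := (i : ℝ) + 9 with hx
  have hx9 : (9 : ℝ) ≤ x := by rw [hx]; linarith [Nat.cast_nonneg (α := ℝ) i]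
  have hc : ((i + 9 : ℕ) : ℝ) = x := by push_cast; rfl
  have e1 : (i : ℝ) + 8 = x - 1 := by rw [hx]; ring
  have e2 : ((i + 1 : ℕ) : ℝ) + 8 = x := by rw [hx]; push_cast; ring
  have e3 : ((i + 1 : ℕ) : ℝ) + 9 = x + 1 := by rw [hx]; push_cast; ring
  calc |(u (i + 9) : ℝ)| / (((i + 9 : ℕ) : ℝ) ^ 2 + 1) ^ (11 / 2 : ℝ)
      ≤ (K * x ^ 8) / ((((i + 9 : ℕ) : ℝ) ^ 2 + 1) ^ 5 * ((i + 9 : ℕ) : ℝ)) :=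
        div_le_div₀ (by positivity) h2 hpos pow_mul_le_rpow
    -- Weakening `(x² + 1)⁵` to `x⁸(x² - 1)` leaves `K / ((x-1)x(x+1))`, which telescopes.
    _ ≤ (K * x ^ 8) / (x ^ 8 * (x ^ 2 - 1) * x) := by
        rw [hc]
        have hx2 : 0 < x ^ 2 - 1 := by nlinarith
        refine div_le_div_of_nonneg_left (by positivity) (by positivity) ?_
        have : x ^ 8 * (x ^ 2 - 1) ≤ (x ^ 2 + 1) ^ 5 := by
          have h0 : 0 ≤ x ^ 2 := by positivity
          nlinarith [pow_nonneg h0 4, pow_nonneg h0 3, pow_nonneg h0 2]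
        exact mul_le_mul_of_nonneg_right this (by linarith)
    _ = _ := by
        rw [e1, e2, e3]
        have h1 : x - 1 ≠ 0 := by linarith
        have h2 : x ≠ 0 := by linarith
        have h3 : x + 1 ≠ 0 := by linarith
        have h4 : x ^ 2 - 1 ≠ 0 := by nlinarith
        rw [show x ^ 2 - 1 = (x - 1) * (x + 1) by ring] at h4 ⊢
        field_simp
        ring

lemma hasSum_telescope : HasSum (fun i : ℕ => 1 / (2 * ((i : ℝ) + 8) * (i + 9)) -
      1 / (2 * (((i + 1 : ℕ) : ℝ) + 8) * ((i + 1 : ℕ) + 9))) (1 / 144) := by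
  rw [hasSum_iff_tendsto_nat_of_nonneg]
  · have h : ∀ n : ℕ, ∑ i ∈ Finset.range n, (1 / (2 * ((i : ℝ) + 8) * (i + 9)) -
      1 / (2 * (((i + 1 : ℕ) : ℝ) + 8) * ((i + 1 : ℕ) + 9))) =
        1 / 144 - 1 / (2 * ((n : ℝ) + 8) * (n + 9)) := by
      intro n
      rw [Finset.sum_range_sub' (fun i : ℕ => 1 / (2 * ((i : ℝ) + 8) * (i + 9)))]
      norm_num
    simp only [h]
    have h0 : Filter.Tendsto (fun n : ℕ => 1 / (2 * ((n : ℝ) + 8) * (n + 9))) Filter.atTop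
        (nhds 0) := by
      refine squeeze_zero (fun n => by positivity) (fun n => ?_)
        tendsto_one_div_add_atTop_nhds_zero_nat
      have : (0 : ℝ) ≤ n := Nat.cast_nonneg n
      gcongr
      nlinarith
    simpa only [sub_zero] using h0.const_sub (1 / 144)
  · intro i
    rw [sub_nonneg]
    push_cast
    gcongr <;> linarith

/-- The tail `m ≥ 9` is at least `-K/144`, the terms `2 ≤ m ≤ 8` are bounded below by
`seriesTerm_ge`, and `45.3` is an upper bound for `2^{11/2} = √2048`. -/
lemma exists_pos_hasSum_seriesTerm {u : ℕ → ℤ} {K : ℕ}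
    (hu : ∀ m : ℕ, 1 ≤ m → |u m| ≤ K * (m : ℤ) ^ 8) (h1 : 0 ≤ u 1)
    (hpos : (K : ℝ) / 144 < u 1 / 45.3 + ∑ i ∈ Finset.range 7,
      -((max 0 (-u (i + 2)) : ℤ) : ℝ) / ((((i + 2 : ℕ) : ℝ) ^ 2 + 1) ^ 5 * (i + 2 : ℕ))) :
    ∃ S : ℝ, 0 < S ∧ HasSum (fun m : ℕ+ => seriesTerm u m) S := by
  have htail : Summable fun i : ℕ => seriesTerm u (i + 9) :=
    Summable.of_norm_bounded (hasSum_telescope.summable.mul_left (K : ℝ)) (abs_seriesTerm_le hu)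
  have hlow : -((K : ℝ) / 144) ≤ ∑' i : ℕ, seriesTerm u (i + 9) := by
    have h := (hasSum_telescope.mul_left (-(K : ℝ)))
    rw [show -((K : ℝ) / 144) = -(K : ℝ) * (1 / 144) by ring, ← h.tsum_eq]
    refine h.summable.tsum_le_tsum (fun i => ?_) htail
    have := (abs_le.mp (abs_seriesTerm_le hu i)).1
    linarith
  have hsum : Summable fun i : ℕ => seriesTerm u (i + 1) :=
    (summable_nat_add_iff 8).mp (by simpa [add_assoc] using htail)
  have hsplit := hsum.sum_add_tsum_nat_add 8
  have h45 : (u 1 : ℝ) / 45.3 ≤ seriesTerm u 1 := by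
    have h0 : (0 : ℝ) ≤ u 1 := by exact_mod_cast h1
    rw [seriesTerm]
    refine div_le_div_of_nonneg_left h0 (by positivity) ?_
    have h2 : ((2 : ℝ) ^ (11 / 2 : ℝ)) ^ 2 = 2048 := by
      rw [← Real.rpow_mul_natCast (by norm_num)]
      norm_num
    have h3 : (2 : ℝ) ^ (11 / 2 : ℝ) ≤ 45.3 := by
      refine le_of_sq_le_sq ?_ (by norm_num)
      rw [h2]
      norm_num
    norm_num at h3 ⊢
    exact h3
  refine ⟨∑' i : ℕ, seriesTerm u (i + 1), ?_, ?_⟩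
  · rw [← hsplit, Finset.sum_range_succ']
    have h8 : ∑ i ∈ Finset.range 7,
        -((max 0 (-u (i + 2)) : ℤ) : ℝ) / ((((i + 2 : ℕ) : ℝ) ^ 2 + 1) ^ 5 * (i + 2 : ℕ)) ≤
        ∑ i ∈ Finset.range 7, seriesTerm u (i + 1 + 1) :=
      Finset.sum_le_sum fun i _ => seriesTerm_ge (by omega)
    simp only [zero_add]
    have e : ∑' i : ℕ, seriesTerm u (i + 8 + 1) = ∑' i : ℕ, seriesTerm u (i + 9) := rfl
    rw [e]
    linarith
  · rw [← Equiv.pnatEquivNat.symm.hasSum_iff]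
    exact hsum.hasSum

lemma tau_sq_add_one_values : ∀ m ∈ Finset.range 9, tau ((m : ℤ) ^ 2 + 1) =
    ([1, 0, 54, 0, 594, 0, -298, 0, -22572] : List ℤ).getD m 0 := by
  intro m hm
  have hm' : m ≤ 8 := by simpa [Nat.lt_succ_iff] using hm
  have : (m : ℤ) ≤ 8 := by exact_mod_cast hm'
  rw [tau_eq_getD (by nlinarith)]
  revert m
  decide +kernel

lemma exists_pos_hasSum_two_mul_shiftedSum_sub :
    ∃ S : ℝ, 0 < S ∧ HasSum (fun m : ℕ+ =>
      seriesTerm (fun m => 2 * shiftedSum m - tau ((m : ℤ) ^ 2 + 1)) m) S := by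
  have h : ∀ m ∈ Finset.range 9, 2 * shiftedSum m - tau ((m : ℤ) ^ 2 + 1) =
      ([1, 2, 56, -196, -240, 772, -11144, 15910, -111360] : List ℤ).getD m 0 := by
    intro m hm
    rw [shiftedSum_values m hm, tau_sq_add_one_values m hm]
    revert m
    decide +kernel
  -- The margin is narrow: `2/45.3 ≈ 0.0442` against `6/144 ≈ 0.0417` and negative parts below
  -- `0.001`.
  refine exists_pos_hasSum_seriesTerm (K := 6) (fun m hm => abs_two_mul_shiftedSum_sub_le hm) ?_ ?_
  · rw [h 1 (by simp)]
    simp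
  · rw [h 1 (by simp), Finset.sum_congr rfl fun i hi => by
      rw [h (i + 2) (by rw [Finset.mem_range] at hi ⊢; omega)]]
    simp only [Finset.sum_range_succ, Finset.sum_range_zero]
    norm_num

lemma exists_pos_hasSum_shiftedSum_sub :
    ∃ S : ℝ, 0 < S ∧ HasSum (fun m : ℕ+ =>
      seriesTerm (fun m => shiftedSum m - tau ((m : ℤ) ^ 2 + 1)) m) S := by
  have h : ∀ m ∈ Finset.range 9, shiftedSum m - tau ((m : ℤ) ^ 2 + 1) =
      ([0, 1, 1, -98, -417, 386, -5423, 7955, -44394] : List ℤ).getD m 0 := by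
    intro m hm
    rw [shiftedSum_values m hm, tau_sq_add_one_values m hm]
    revert m
    decide +kernel
  refine exists_pos_hasSum_seriesTerm (K := 2) (fun m hm => abs_shiftedSum_sub_le hm) ?_ ?_
  · rw [h 1 (by simp)]
    simp
  · rw [h 1 (by simp), Finset.sum_congr rfl fun i hi => by
      rw [h (i + 2) (by rw [Finset.mem_range] at hi ⊢; omega)]]
    simp only [Finset.sum_range_succ, Finset.sum_range_zero]
    norm_num

/-! ### The three series over the complex numbers -/

lemma HasPositiveSum.of_real {u : ℕ+ → ℂ} {v : ℕ+ → ℝ} (huv : ∀ m, u m = (v m : ℂ))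
    (hv : ∃ S : ℝ, 0 < S ∧ HasSum v S) : HasPositiveSum u := by
  obtain ⟨S, hS, h⟩ := hv
  refine ⟨S, hS, ?_⟩
  rw [funext huv]
  exact_mod_cast h

lemma hasPositiveSum_sum_Icc_neg : HasPositiveSum (fun m : ℕ+ =>
    (∑ r ∈ Finset.Icc (-((m : ℕ) : ℤ)) ((m : ℕ) : ℤ),
      fourierCoeff deltaFour (((m : ℕ) : ℤ) ^ 2 + 1 - r ^ 2)) /
      (((((m : ℕ) : ℝ) ^ 2 + 1) ^ (11 / 2 : ℝ) : ℝ) : ℂ)) := by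
  refine .of_real (fun m => ?_) exists_pos_hasSum_two_mul_shiftedSum_sub
  simp only [fourierCoeff_deltaFour]
  rw [seriesTerm, ← sum_Icc_neg_eq, Complex.ofReal_div]
  push_cast
  rfl

lemma hasPositiveSum_sum_Icc_one : HasPositiveSum (fun m : ℕ+ =>
    (∑ r ∈ Finset.Icc (1 : ℤ) (((m : ℕ) : ℤ) ^ 2 + 1),
      fourierCoeff deltaFour (((m : ℕ) : ℤ) ^ 2 + 1 - r ^ 2)) /
      (((((m : ℕ) : ℝ) ^ 2 + 1) ^ (11 / 2 : ℝ) : ℝ) : ℂ)) := by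
  refine .of_real (fun m => ?_) exists_pos_hasSum_shiftedSum_sub
  simp only [fourierCoeff_deltaFour]
  rw [seriesTerm, ← sum_Icc_one_eq m.pos, Complex.ofReal_div]
  push_cast
  rfl

lemma fourierCoeff_theta_mul_deltaFour {m : ℕ} (hm : 1 ≤ m) :
    fourierCoeff (fun z => theta z * deltaFour z) ((m ^ 2 + 1 : ℕ) : ℤ) =
      ((2 * shiftedSum m - tau ((m : ℤ) ^ 2 + 1) : ℤ) : ℂ) := by
  rw [fourierCoeff_theta_mul, ← sum_thetaCoeff_mul_tau hm, Int.cast_sum]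
  refine Finset.sum_congr rfl fun r _ => ?_
  rw [fourierCoeff_theta, fourierCoeff_deltaFour, Int.cast_mul]

lemma hasPositiveSum_theta_mul_deltaFour : HasPositiveSum (fun m : ℕ+ =>
    fourierCoeff (fun z => theta z * deltaFour z) ((m : ℕ) + 1 : ℤ) *
      conj (fourierCoeff theta ((m : ℕ) : ℤ)) /
      ((((m : ℕ) + 1 : ℝ) ^ (11 / 2 : ℝ) : ℝ) : ℂ)) := by
  obtain ⟨S, hS, h⟩ := exists_pos_hasSum_two_mul_shiftedSum_sub
  refine ⟨2 * S, by positivity, ?_⟩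
  have h2 := (Complex.hasSum_ofReal.mpr (h.mul_left 2))
  rw [Complex.ofReal_mul, Complex.ofReal_ofNat] at h2
  -- Only squares `m = k²` contribute, each with `b(k²) = 2`, so the sum is twice that of the second
  -- series.
  have hinj : Function.Injective fun k : ℕ+ => k ^ 2 := fun a b hab =>
    PNat.coe_injective (Nat.pow_left_injective two_ne_zero (by
      simpa using congrArg PNat.val hab))
  refine (hinj.hasSum_iff fun m hm => ?_).mp ?_
  · have : ¬ IsSquare (m : ℕ) := by
      rintro ⟨r, hr⟩
      have hr0 : 0 < r := Nat.pos_of_ne_zero fun h0 => by simp [h0] at hr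
      refine hm ⟨⟨r, hr0⟩, PNat.coe_injective ?_⟩
      rw [hr, ← sq]
      exact PNat.pow_coe _ _
    rw [fourierCoeff_theta, thetaCoeff, if_neg this, if_neg m.ne_zero]
    simp
  · rw [Complex.ofReal_mul, Complex.ofReal_ofNat]
    convert! h2 using 1
    funext k
    have hk := fourierCoeff_theta_mul_deltaFour k.pos
    have hsq : IsSquare ((k ^ 2 : ℕ+) : ℕ) := ⟨k, by rw [PNat.pow_coe, sq]⟩
    simp only [Function.comp_apply]
    rw [fourierCoeff_theta, thetaCoeff, if_pos hsq, if_neg (PNat.ne_zero _)]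
    rw [show (((k ^ 2 : ℕ+) : ℕ) + 1 : ℤ) = (((k : ℕ) ^ 2 + 1 : ℕ) : ℤ) by push_cast; rfl, hk,
      seriesTerm, PNat.pow_coe]
    simp only [Nat.cast_pow]
    rw [Complex.ofReal_mul, Complex.ofReal_div, Complex.ofReal_intCast]
    simp only [sub_zero, Int.cast_ofNat, map_ofNat, Complex.ofReal_ofNat]
    ring

lemma span_deltaFour : Submodule.span ℂ {deltaFour} = ⊤ := by
  refine (Submodule.eq_top_iff').mpr fun f => Submodule.mem_span_singleton.mpr ?_
  obtain ⟨c, hc⟩ := exists_eq_smul_deltaFour f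
  exact ⟨c, hc.symm⟩

end ThetaNewform

end

theorem mainTheorem2 :
    Module.finrank ℂ (ThetaNewform.CuspSpace 4 6) = 1 ∧
    (∃! Δ : ThetaNewform.CuspSpace 4 6, ThetaNewform.IsNewform Δ) ∧
    ∀ Δ : ThetaNewform.CuspSpace 4 6, ThetaNewform.IsNewform Δ →
      Submodule.span ℂ {Δ} = ⊤ ∧
      (∀ n : ℕ, ThetaNewform.fourierCoeff (fun z => ThetaNewform.theta z * Δ z) n =
        ∑ r ∈ Finset.range (n + 1), ThetaNewform.fourierCoeff ThetaNewform.theta r *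
          ThetaNewform.fourierCoeff Δ ((n : ℤ) - (r : ℤ))) ∧
      ThetaNewform.HasPositiveSum (fun m : ℕ+ =>
        ThetaNewform.fourierCoeff (fun z => ThetaNewform.theta z * Δ z) ((m : ℕ) + 1 : ℤ) *
          conj (ThetaNewform.fourierCoeff ThetaNewform.theta ((m : ℕ) : ℤ)) /
          ((((m : ℕ) + 1 : ℝ) ^ (11 / 2 : ℝ) : ℝ) : ℂ)) ∧
      ThetaNewform.HasPositiveSum (fun m : ℕ+ =>
        (∑ r ∈ Finset.Icc (-((m : ℕ) : ℤ)) ((m : ℕ) : ℤ),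
          ThetaNewform.fourierCoeff Δ (((m : ℕ) : ℤ) ^ 2 + 1 - r ^ 2)) /
          (((((m : ℕ) : ℝ) ^ 2 + 1) ^ (11 / 2 : ℝ) : ℝ) : ℂ)) ∧
      ThetaNewform.HasPositiveSum (fun m : ℕ+ =>
        (∑ r ∈ Finset.Icc (1 : ℤ) (((m : ℕ) : ℤ) ^ 2 + 1),
          ThetaNewform.fourierCoeff Δ (((m : ℕ) : ℤ) ^ 2 + 1 - r ^ 2)) /
          (((((m : ℕ) : ℝ) ^ 2 + 1) ^ (11 / 2 : ℝ) : ℝ) : ℂ)) := by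
  refine ⟨ThetaNewform.finrank_cuspSpace_four_six, ⟨ThetaNewform.deltaFour,
    ThetaNewform.isNewform_deltaFour, fun f hf => ThetaNewform.eq_deltaFour_of_isNewform hf⟩, ?_⟩
  intro Δ hΔ
  obtain rfl := ThetaNewform.eq_deltaFour_of_isNewform hΔ
  exact ⟨ThetaNewform.span_deltaFour, ThetaNewform.fourierCoeff_theta_mul _,
    ThetaNewform.hasPositiveSum_theta_mul_deltaFour, ThetaNewform.hasPositiveSum_sum_Icc_neg,
    ThetaNewform.hasPositiveSum_sum_Icc_one⟩
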